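/- Let $\varepsilon>0$ and let $\xi$ be a (real or complex) random variable with a symmetric distribution, $\xi\overset{\text{law}}{=}-\xi$, such that $\mathbb{E}[\xi]=0$, $\mathbb{E}[|\xi|^2]=1$ and $\mathbb{E}[|\xi|^{2+\varepsilon}]<\infty$. For every $n\ge 1$ let $x_{ij}=x^{(n)}_{ij}$ $(i,j\in[n])$ be i.i.d. copies of $\xi$, let $b_{ij}=b^{(n)}_{ij}$ be deterministic real numbers, and put $A_n=(b_{ij}x_{ij})_{i,j\in[n]}$ and $S_n=(s_{ij})_{i,j\in[n]}$ with $s_{ij}=b_{ij}^2$ (nothing is assumed on the joint distribution of the matrices $A_n$ for different $n$). Assume that there is a constant $C>0$, independent of $n$, such that $s_{ij}\le C/n$ for all $n$ and all $i,j\in[n]$. Write $\rho(M)$ for the spectral radius of a matrix $M$, and let $$\sigma_n:=\max\Big(\max_{i\in[n]}\sqrt{\textstyle\sum_{j=1}^n s_{ij}},\ \max_{j\in[n]}\sqrt{\textstyle\sum_{i=1}^n s_{ij}}\Big).$$ 1. With probability $1-o(1)$, $\limsup_{n\to\infty}(\rho(A_n)-\sigma_n)\le 0$, in the following sense: for every $\delta>0$,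 $$\lim_{n\to\infty}\mathbb{P}\big(\rho(A_n)\le\sigma_n+\delta\big)=1.$$ 2. If, moreover, there is a constant $c>0$, independent of $n$, such that $s_{ij}\ge c/n$ for all $n$ and all $i,j\in[n]$, then for every $\delta>0$, $$\lim_{n\to\infty}\mathbb{P}\big(\rho(A_n)\le\sqrt{\rho(S_n)}+\delta\big)=1.$$ -/

import Mathlib

open Filter Topology MeasureTheory ProbabilityTheory

noncomputable section

/-- The spectrum of a complex matrix is finite, so its spectral radius is a finite number. -/
theorem spectralRadius_matrix_lt_top {n : ℕ} (M : Matrix (Fin n) (Fin n) ℂ) :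
    spectralRadius ℂ M < ⊤ := by
  have hfin : (spectrum ℂ M).Finite := Matrix.finite_spectrum M
  obtain ⟨R, hR⟩ := (hfin.image (fun z : ℂ => ‖z‖₊)).bddAbove
  refine lt_of_le_of_lt (b := (R : ENNReal)) ?_ ENNReal.coe_lt_top
  unfold spectralRadius
  refine iSup₂_le fun k hk => ?_
  exact ENNReal.coe_le_coe.mpr (hR ⟨k, hk, rfl⟩)

/-- The spectral radius `ρ(M)`, the largest modulus of a (complex) eigenvalue of `M`, as a
real number. -/
def rho {n : ℕ} (M : Matrix (Fin n) (Fin n) ℂ) : ℝ :=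
  (spectralRadius ℂ M).toReal

/-- The variance profile `S = (b i j ^ 2)`. -/
def varianceProfile {n : ℕ} (b : Matrix (Fin n) (Fin n) ℝ) : Matrix (Fin n) (Fin n) ℝ :=
  Matrix.of fun i j => b i j ^ 2

/-- The parameter `σ` of a variance profile `S`: the maximum over all rows and all columns of the
square root of the row sum, respectively of the column sum, of `S`. -/
def maxRowColumn {n : ℕ} (S : Matrix (Fin n) (Fin n) ℝ) : ℝ :=
  max (⨆ i, √(∑ j, S i j)) (⨆ j, √(∑ i, S i j))

/-- The matrix `A = (b i j * x i j)`. -/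
def weightedMatrix {n : ℕ} (b : Matrix (Fin n) (Fin n) ℝ) (x : Matrix (Fin n) (Fin n) ℂ) :
    Matrix (Fin n) (Fin n) ℂ :=
  Matrix.of fun i j => (b i j : ℂ) * x i j

end

/-! After division by r + δ the claim becomes: with high probability `det (1 - z A)` has no zero in
the closed unit disc, provided that the rescaled profile S satisfies tr S^j ≤ D θ^(2j) with θ < 1.
The argument uses the coefficients d_k of this polynomial instead of high moments of A.

Expanding the determinant writes d_k as a signed sum of monomials indexed by permutations of
k-subsets. Symmetry of the law makes distinct monomials orthogonal, so E|d_k|² is the sum of the k ×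
k principal permanents of S (`integral_norm_sq_coeff`). Removing the cycle through a marked point
yields a Newton inequality for these sums (`succ_mul_permanentSum_le`), and hence a bound of E|d_k|²
by the square of a summable sequence that does not depend on n.

Let A' be A with entries truncated at a fixed level M. Its low coefficients are L²-close to those of
A. For fixed j the second moment of tr A'^j is controlled, up to O(1/n), by traces of powers of S,
since the dominant pairs of closed walks visit every vertex exactly twice
(`integral_norm_sq_trace_le`). Through Newton's identities this bounds the coefficients of 1 / det
(1 - z A') up to a fixed degree 2ℓ by a summable sequence, with high probability. Multiplying det (1
- z A) by that truncated inverse gives 1 plus an error of modulus less than 1 on the disc, so there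
is no zero (`sum_mul_pow_ne_zero`); `exists_forall_measureReal_zero_le` chooses the constants.

It remains to bound tr S^(m+1). In the first claim it is at most C σ^(2m), by row sums. In the
second, the lower bound c/n makes every row sum of S^(m+1) at least c/n times the sum of all entries
of S^m, so the trace is at most (C/c) ρ(S)^(m+1) (`trace_pow_le_rho_pow`). -/

/-! ### Jacobi's formula and Newton's identities for `det (1 - X A)`. -/

section TraceSeries

open Polynomial in
/-- Jacobi's formula for the derivative of the determinant of a polynomial matrix. -/
theorem derivative_det_eq_trace {R ι : Type*} [CommRing R] [Fintype ι] [DecidableEq ι]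
    (M : Matrix ι ι R[X]) :
    derivative M.det = (M.adjugate * M.map derivative).trace := by
  -- Cramer's rule: each diagonal entry is the determinant with one column differentiated, so the
  -- trace is the Leibniz rule taken column by column.
  have hcol : ∀ i, ((M.adjugate * M.map derivative) i i) =
      (M.updateCol i fun j => derivative (M j i)).det := fun i => by
    rw [← Matrix.cramer_apply, Matrix.cramer_eq_adjugate_mulVec]
    simp [Matrix.mul_apply, Matrix.mulVec, dotProduct]
  rw [Matrix.trace]
  simp only [Matrix.diag_apply, hcol]
  simp only [Matrix.det_apply', map_sum]
  rw [Finset.sum_comm]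
  refine Finset.sum_congr rfl fun σ _ => ?_
  rw [derivative_intCast_mul, derivative_prod_finset, Finset.mul_sum]
  refine Finset.sum_congr rfl fun i _ => ?_
  congr 1
  rw [← Finset.mul_prod_erase _ _ (Finset.mem_univ i), mul_comm]
  simp only [Matrix.updateCol_self]
  congr 1
  refine Finset.prod_congr rfl fun j hj => ?_
  rw [Matrix.updateCol_ne (Finset.ne_of_mem_erase hj)]

/-- The logarithmic derivative of `det (1 - X A)` is the generating series of `-tr (A ^ (k+1))`. -/
theorem derivative_charpolyRev {R ι : Type*} [CommRing R] [Fintype ι] [DecidableEq ι]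
    (A : Matrix ι ι R) :
    PowerSeries.derivative R (A.charpolyRev : PowerSeries R) =
      -((A.charpolyRev : PowerSeries R) * PowerSeries.mk fun k => (A ^ (k + 1)).trace) := by
  set M : Matrix ι ι (Polynomial R) := 1 - (Polynomial.X : Polynomial R) • A.map Polynomial.C
    with hM
  have hdet : A.charpolyRev = M.det := rfl
  have hM' : M.map Polynomial.derivative = -A.map Polynomial.C := by
    ext i j : 1
    by_cases h : i = j <;> simp [hM, h]
  let φ : Polynomial R →+* PowerSeries R := Polynomial.coeToPowerSeries.ringHom
  have hφ : ∀ p : Polynomial R, φ p = (p : PowerSeries R) := fun p => rfl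
  -- The Neumann series of `(1 - X A)⁻¹`. It turns the adjugate into `det • G`, and the trace of `G`
  -- times `A` is the series wanted.
  let G : Matrix ι ι (PowerSeries R) := Matrix.of fun i j => PowerSeries.mk fun k => (A ^ k) i j
  have hG : φ.mapMatrix M * G = 1 := by
    have h1 : φ.mapMatrix M = 1 - (PowerSeries.X : PowerSeries R) • A.map PowerSeries.C := by
      ext i j : 1
      by_cases h : i = j <;> simp [hM, h, hφ] <;> exact PowerSeries.commute_X _
    rw [h1, sub_mul, one_mul]
    ext i j k : 2
    simp only [Matrix.sub_apply, Matrix.smul_mul, Matrix.smul_apply, smul_eq_mul, map_sub,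
      Matrix.mul_apply, Matrix.map_apply, G, Matrix.of_apply]
    cases k with
    | zero => by_cases h : i = j <;> simp [h, Matrix.one_apply]
    | succ k =>
      rw [PowerSeries.coeff_succ_X_mul, map_sum]
      simp only [PowerSeries.coeff_mk, PowerSeries.coeff_C_mul]
      rw [pow_succ', Matrix.mul_apply, sub_self]
      by_cases h : i = j <;> simp [h, Matrix.one_apply, PowerSeries.coeff_one]
  have hadj : φ.mapMatrix M.adjugate = φ M.det • G := by
    have h2 : φ.mapMatrix M.adjugate * φ.mapMatrix M = φ M.det • 1 := by
      rw [← map_mul, Matrix.adjugate_mul]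
      ext i j : 1
      by_cases h : i = j <;> simp [h]
    calc φ.mapMatrix M.adjugate = φ.mapMatrix M.adjugate * (φ.mapMatrix M * G) := by
          rw [hG, mul_one]
      _ = φ M.det • G := by rw [← mul_assoc, h2, Matrix.smul_mul, one_mul]
  rw [PowerSeries.derivative_coe, hdet, derivative_det_eq_trace, hM', mul_neg, Matrix.trace_neg,
    ← hφ, ← hφ, map_neg]
  congr 1
  have h3 : φ (M.adjugate * A.map Polynomial.C).trace =
      (φ.mapMatrix M.adjugate * A.map PowerSeries.C).trace := by
    simp only [Matrix.trace, Matrix.diag_apply, Matrix.mul_apply, map_sum, map_mul,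
      Matrix.map_apply, RingHom.mapMatrix_apply]
    simp only [hφ, Polynomial.coe_C]
  rw [h3, hadj, Matrix.smul_mul, Matrix.trace_smul, smul_eq_mul]
  congr 1
  ext k
  simp only [Matrix.trace, Matrix.diag_apply, Matrix.mul_apply, map_sum, Matrix.map_apply, G,
    Matrix.of_apply, PowerSeries.coeff_mul_C, PowerSeries.coeff_mk, pow_succ]

/-- The coefficients of the inverse of `det (1 - X A)` (the complete homogeneous symmetric
polynomials in the eigenvalues of `A`). -/
noncomputable def invRevCoeff {ι : Type*} [Fintype ι] [DecidableEq ι] (A : Matrix ι ι ℂ) (k : ℕ) :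
    ℂ :=
  PowerSeries.coeff k (A.charpolyRev : PowerSeries ℂ)⁻¹

variable {ι : Type*} [Fintype ι] [DecidableEq ι] (A : Matrix ι ι ℂ)

theorem constantCoeff_charpolyRev :
    PowerSeries.constantCoeff (A.charpolyRev : PowerSeries ℂ) = 1 := by
  have := Matrix.eval_charpolyRev (M := A)
  rw [← Polynomial.coeff_zero_eq_eval_zero] at this
  rw [Polynomial.constantCoeff_coe, this]

theorem sum_coeff_mul_invRevCoeff (m : ℕ) :
    ∑ p ∈ Finset.HasAntidiagonal.antidiagonal m, A.charpolyRev.coeff p.1 * invRevCoeff A p.2 =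
      if m = 0 then 1 else 0 := by
  have h : (A.charpolyRev : PowerSeries ℂ) * (A.charpolyRev : PowerSeries ℂ)⁻¹ = 1 :=
    PowerSeries.mul_inv_cancel _ (by rw [constantCoeff_charpolyRev]; exact one_ne_zero)
  have := congrArg (PowerSeries.coeff m) h
  rw [PowerSeries.coeff_mul, PowerSeries.coeff_one] at this
  simpa [invRevCoeff] using this

theorem invRevCoeff_zero : invRevCoeff A 0 = 1 := by
  rw [invRevCoeff, PowerSeries.coeff_zero_eq_constantCoeff_apply, PowerSeries.constantCoeff_inv,
    constantCoeff_charpolyRev, inv_one]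

/-- Newton's identity for the complete homogeneous symmetric polynomials. -/
theorem succ_mul_invRevCoeff (k : ℕ) :
    ((k : ℂ) + 1) * invRevCoeff A (k + 1) =
      ∑ i ∈ Finset.range (k + 1), (A ^ (k + 1 - i)).trace * invRevCoeff A i := by
  set F : PowerSeries ℂ := (A.charpolyRev : PowerSeries ℂ) with hF
  have hF0 : PowerSeries.constantCoeff F ≠ 0 := by
    rw [constantCoeff_charpolyRev]; exact one_ne_zero
  have h : PowerSeries.derivative ℂ F⁻¹ =
      F⁻¹ * PowerSeries.mk fun k => (A ^ (k + 1)).trace := by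
    rw [PowerSeries.derivative_inv', derivative_charpolyRev]
    have := PowerSeries.mul_inv_cancel F hF0
    linear_combination (F⁻¹ * PowerSeries.mk fun k => (A ^ (k + 1)).trace) * this
  have h1 := congrArg (PowerSeries.coeff k) h
  rw [PowerSeries.coeff_derivative, PowerSeries.coeff_mul,
    Finset.Nat.sum_antidiagonal_eq_sum_range_succ_mk] at h1
  rw [mul_comm]
  refine h1.trans (Finset.sum_congr rfl fun i hi => ?_)
  rw [PowerSeries.coeff_mk, mul_comm]
  have : k - i + 1 = k + 1 - i := by have := Finset.mem_range.1 hi; omega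
  rw [this]; rfl

end TraceSeries

/-! ### Majorization by negative binomial coefficients. -/

section Recursion

/-- The coefficients of `(1 - q X) ^ (-(B + 1))`. -/
noncomputable def negBinomCoeff (B : ℕ) (q : ℝ) (k : ℕ) : ℝ := ((k + B).choose B : ℝ) * q ^ k

theorem summable_negBinomCoeff (B : ℕ) {q : ℝ} (hq : 0 ≤ q) (hq1 : q < 1) :
    Summable (negBinomCoeff B q) := by
  have : ‖q‖ < 1 := by rwa [Real.norm_of_nonneg hq]
  exact summable_choose_mul_geometric_of_norm_lt_one B this

/-- Newton's recursion for `B + 1` eigenvalues all equal to `q`, the extremal case of the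
majorization below; it reduces to the hockey-stick identity. -/
theorem succ_mul_negBinomCoeff (B : ℕ) (q : ℝ) (k : ℕ) :
    ((k : ℝ) + 1) * negBinomCoeff B q (k + 1) =
      ∑ i ∈ Finset.range (k + 1), ((B + 1 : ℕ) : ℝ) * q ^ (k + 1 - i) * negBinomCoeff B q i := by
  have h1 : ∀ i ∈ Finset.range (k + 1), ((B + 1 : ℕ) : ℝ) * q ^ (k + 1 - i) * negBinomCoeff B q i =
      (((B + 1 : ℕ) : ℝ) * q ^ (k + 1)) * ((i + B).choose B : ℝ) := fun i hi => by
    have : q ^ (k + 1) = q ^ (k + 1 - i) * q ^ i := by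
      rw [← pow_add]; congr 1; have := Finset.mem_range.1 hi; omega
    rw [this, negBinomCoeff]; ring
  rw [Finset.sum_congr rfl h1, ← Finset.mul_sum, ← Nat.cast_sum, Nat.sum_range_add_choose,
    negBinomCoeff]
  have h2 : (k + 1) * (k + 1 + B).choose B = (B + 1) * (k + B + 1).choose (B + 1) := by
    have := Nat.choose_succ_right_eq (k + B + 1) B
    have e : k + B + 1 - B = k + 1 := by omega
    rw [e] at this
    have e2 : k + 1 + B = k + B + 1 := by omega
    rw [e2]; linarith
  have h3 : ((k : ℝ) + 1) * ((k + 1 + B).choose B : ℝ) =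
      ((B + 1 : ℕ) : ℝ) * ((k + B + 1).choose (B + 1) : ℝ) := by exact_mod_cast h2
  calc _ = (((k : ℝ) + 1) * ((k + 1 + B).choose B : ℝ)) * q ^ (k + 1) := by ring
    _ = _ := by rw [h3]; push_cast; ring

/-- Majorization of a sequence obeying a Newton type recursion. -/
theorem le_negBinomCoeff_of_recursion {B K : ℕ} {q : ℝ} (hq : 0 ≤ q) {u t : ℕ → ℝ}
    (hu : ∀ k, 0 ≤ u k) (hu0 : u 0 ≤ 1)
    (ht : ∀ j, 1 ≤ j → j ≤ K → t j ≤ ((B + 1 : ℕ) : ℝ) * q ^ j)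
    (hrec : ∀ k, k + 1 ≤ K →
      ((k : ℝ) + 1) * u (k + 1) ≤ ∑ i ∈ Finset.range (k + 1), t (k + 1 - i) * u i)
    (k : ℕ) (hk : k ≤ K) : u k ≤ negBinomCoeff B q k := by
  induction k using Nat.strong_induction_on with
  | _ k ih =>
    cases k with
    | zero => simpa [negBinomCoeff] using hu0
    | succ k =>
      have hpos : (0 : ℝ) < (k : ℝ) + 1 := by positivity
      refine le_of_mul_le_mul_left ?_ hpos
      rw [succ_mul_negBinomCoeff]
      refine (hrec k hk).trans (Finset.sum_le_sum fun i hi => ?_)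
      have hi' := Finset.mem_range.1 hi
      have h1 := ht (k + 1 - i) (by omega) (by omega)
      refine (mul_le_mul_of_nonneg_right h1 (hu i)).trans ?_
      exact mul_le_mul_of_nonneg_left (ih i (by omega) (by omega)) (by positivity)

end Recursion

/-! ### Coefficients of `det (1 - z A)` as sums over partial permutations. -/

section PartialPermutations

variable {ι : Type*} [Fintype ι] [DecidableEq ι]

/-- Permutations of a `k`-element subset of `ι`, coded as a pair of the subset and the extension by
the identity. -/
def partialPerms (ι : Type*) [Fintype ι] [DecidableEq ι] (k : ℕ) :
    Finset (Equiv.Perm ι × Finset ι) :=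
  Finset.univ.filter fun a => a.2.card = k ∧ ∀ i, i ∉ a.2 → a.1 i = i

theorem mem_partialPerms {k : ℕ} {a : Equiv.Perm ι × Finset ι} :
    a ∈ partialPerms ι k ↔ a.2.card = k ∧ ∀ i, i ∉ a.2 → a.1 i = i := by
  simp [partialPerms]

/-- Each factor of the Leibniz formula is `-z A` plus a Kronecker delta. The subset records where
the first term is chosen; the delta forces the permutation to fix all other points. -/
theorem det_one_sub_smul_eq_sum {R : Type*} [CommRing R] (A : Matrix ι ι R) (z : R) :
    (1 - z • A).det = ∑ k ∈ Finset.range (Fintype.card ι + 1),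
      (∑ a ∈ partialPerms ι k,
        (-1) ^ k * ((Equiv.Perm.sign a.1 : ℤ) : R) * ∏ i ∈ a.2, A i (a.1 i)) * z ^ k := by
  have h1 : (1 - z • A).det = ∑ a : Equiv.Perm ι × Finset ι,
      if ∀ i, i ∉ a.2 → a.1 i = i then
        (-1) ^ a.2.card * ((Equiv.Perm.sign a.1 : ℤ) : R) * (∏ i ∈ a.2, A i (a.1 i)) *
          z ^ a.2.card else 0 := by
    rw [← Matrix.det_transpose, Matrix.det_apply', Fintype.sum_prod_type]
    refine Finset.sum_congr rfl fun σ _ => ?_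
    have : ∀ i, (1 - z • A).transpose (σ i) i =
        -(z * A i (σ i)) + if σ i = i then 1 else 0 := fun i => by
      simp only [Matrix.transpose_apply, Matrix.sub_apply, Matrix.one_apply, Matrix.smul_apply,
        smul_eq_mul, eq_comm (a := i)]
      ring
    simp only [this]
    rw [Finset.prod_add, Finset.mul_sum, Finset.powerset_univ]
    refine Finset.sum_congr rfl fun J _ => ?_
    split_ifs with h
    · rw [Finset.prod_eq_one (s := Finset.univ \ J), mul_one, Finset.prod_neg,
        Finset.prod_mul_distrib, Finset.prod_const]
      · ring
      · intro i hi
        rw [if_pos (h i (by simpa using hi))]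
    · push Not at h
      obtain ⟨i, hi, hσ⟩ := h
      rw [Finset.prod_eq_zero (s := Finset.univ \ J) (i := i) (by simpa using hi) (if_neg hσ)]
      simp
  rw [h1, ← Finset.sum_fiberwise_of_maps_to (s := Finset.univ)
    (t := Finset.range (Fintype.card ι + 1)) (g := fun a => a.2.card)
    (fun a _ => Finset.mem_range.2 (Nat.lt_succ_of_le (Finset.card_le_univ _)))]
  refine Finset.sum_congr rfl fun k _ => ?_
  rw [Finset.sum_mul, ← Finset.sum_filter, Finset.filter_filter]
  refine Finset.sum_congr rfl fun a ha => ?_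
  rw [(mem_partialPerms.1 ha).1]

theorem partialPerms_eq_empty {k : ℕ} (hk : Fintype.card ι < k) : partialPerms ι k = ∅ := by
  refine Finset.eq_empty_of_forall_notMem fun a ha => ?_
  have := (mem_partialPerms.1 ha).1
  have := Finset.card_le_univ a.2
  omega

theorem coeff_charpolyRev {R : Type*} [CommRing R] (A : Matrix ι ι R) (k : ℕ) :
    A.charpolyRev.coeff k = ∑ a ∈ partialPerms ι k,
      (-1) ^ k * ((Equiv.Perm.sign a.1 : ℤ) : R) * ∏ i ∈ a.2, A i (a.1 i) := by
  have h : A.charpolyRev = ∑ k ∈ Finset.range (Fintype.card ι + 1),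
      Polynomial.C (∑ a ∈ partialPerms ι k,
        (-1) ^ k * ((Equiv.Perm.sign a.1 : ℤ) : R) * ∏ i ∈ a.2, A i (a.1 i)) *
        Polynomial.X ^ k := by
    rw [Matrix.charpolyRev, det_one_sub_smul_eq_sum]
    simp [map_sum, map_prod]
  rw [h, Polynomial.finsetSum_coeff]
  simp only [Polynomial.coeff_C_mul_X_pow]
  rw [Finset.sum_ite_eq]
  split_ifs with hk
  · rfl
  · rw [partialPerms_eq_empty (by simpa using hk), Finset.sum_empty]

theorem det_one_sub_smul {R : Type*} [CommRing R] (A : Matrix ι ι R) (z : R) :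
    (1 - z • A).det =
      ∑ k ∈ Finset.range (Fintype.card ι + 1), A.charpolyRev.coeff k * z ^ k := by
  simp only [coeff_charpolyRev]
  exact det_one_sub_smul_eq_sum A z

/-- The sum of the permanents of the `k × k` principal submatrices. -/
def permanentSum {R : Type*} [CommSemiring R] (T : Matrix ι ι R) (k : ℕ) : R :=
  ∑ a ∈ partialPerms ι k, ∏ i ∈ a.2, T i (a.1 i)

theorem permanentSum_zero (T : Matrix ι ι ℝ) : permanentSum T 0 = 1 := by
  have : partialPerms ι 0 = {(1, ∅)} := by
    ext ⟨σ, J⟩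
    simp only [mem_partialPerms, Finset.card_eq_zero, Finset.mem_singleton, Prod.mk.injEq]
    constructor
    · rintro ⟨rfl, h⟩
      exact ⟨Equiv.ext fun i => by simpa using h i, rfl⟩
    · rintro ⟨rfl, rfl⟩
      simp
  simp [permanentSum, this]

theorem permanentSum_nonneg {T : Matrix ι ι ℝ} (hT : ∀ i j, 0 ≤ T i j) (k : ℕ) :
    0 ≤ permanentSum T k :=
  Finset.sum_nonneg fun _ _ => Finset.prod_nonneg fun _ _ => hT _ _

end PartialPermutations

/-! ### Traces of powers as sums over closed walks. -/

section ClosedWalks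

variable {ι : Type*} [Fintype ι] [DecidableEq ι] {R : Type*} [CommSemiring R]

/-- The closing factor `G` is general so that the induction can absorb one step, replacing `G` by `T
* G`. -/
theorem sum_walks (T G : Matrix ι ι R) (m : ℕ) :
    ∑ γ : Fin (m + 1) → ι, (∏ t : Fin m, T (γ t.castSucc) (γ t.succ)) * G (γ (Fin.last m)) (γ 0) =
      (T ^ m * G).trace := by
  induction m generalizing G with
  | zero =>
    rw [← (Equiv.funUnique (Fin 1) ι).symm.sum_comp]
    simp [Matrix.trace]
  | succ m ih =>
    have h : T ^ (m + 1) * G = T ^ m * (T * G) := by rw [pow_succ, mul_assoc]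
    rw [h, ← ih, ← (Fin.snocEquiv fun _ => ι).sum_comp, Fintype.sum_prod_type, Finset.sum_comm]
    refine Finset.sum_congr rfl fun γ _ => ?_
    rw [Matrix.mul_apply, Finset.mul_sum]
    refine Finset.sum_congr rfl fun x _ => ?_
    rw [Fin.prod_univ_castSucc]
    have h0 : Fin.snocEquiv (fun _ : Fin (m + 2) => ι) (x, γ) 0 = γ 0 := by
      simp [Fin.snocEquiv]
    have hc : ∀ t : Fin (m + 1),
        Fin.snocEquiv (fun _ : Fin (m + 2) => ι) (x, γ) t.castSucc = γ t := fun t => by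
      simp [Fin.snocEquiv]
    have hl : Fin.snocEquiv (fun _ : Fin (m + 2) => ι) (x, γ) (Fin.last (m + 1)) = x := by
      simp [Fin.snocEquiv]
    have hs : ∀ t : Fin m, (t.castSucc).succ = (t.succ).castSucc := fun t => rfl
    simp only [h0, hc, hl, hs, Fin.succ_last]
    ring

/-- The trace of a power as a sum over closed walks. -/
theorem trace_pow_eq_sum_closedWalks (T : Matrix ι ι R) (m : ℕ) :
    (T ^ (m + 1)).trace = ∑ γ : Fin (m + 1) → ι, ∏ t, T (γ t) (γ (t + 1)) := by
  rw [pow_succ, ← sum_walks]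
  refine Finset.sum_congr rfl fun γ _ => ?_
  rw [Fin.prod_univ_castSucc]
  simp

end ClosedWalks

/-! ### A Newton inequality for principal permanents. -/

section CycleRemoval

variable {ι : Type*} [Fintype ι] [DecidableEq ι]

omit [DecidableEq ι] in
theorem sameCycle_iff_exists_lt_minimalPeriod (σ : Equiv.Perm ι) (i x : ι) :
    σ.SameCycle i x ↔ ∃ t < Function.minimalPeriod σ i, σ^[t] i = x := by
  have hp : 0 < Function.minimalPeriod σ i :=
    Function.minimalPeriod_pos_of_mem_periodicPts (σ.injective.mem_periodicPts i)
  constructor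
  · intro h
    obtain ⟨t, -, ht⟩ := h.exists_pow_eq'
    refine ⟨t % Function.minimalPeriod σ i, Nat.mod_lt _ hp, ?_⟩
    rw [Function.iterate_mod_minimalPeriod_eq, ← Equiv.Perm.coe_pow, ht]
  · rintro ⟨t, -, rfl⟩
    exact ⟨t, by simp [Equiv.Perm.coe_pow]⟩

theorem mul_cycleOf_inv_apply (σ : Equiv.Perm ι) (i x : ι) :
    (σ * (σ.cycleOf i)⁻¹) x = if σ.SameCycle i x then x else σ x := by
  rw [Equiv.Perm.mul_apply, Equiv.Perm.cycleOf_inv, Equiv.Perm.cycleOf_apply]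
  simp only [Equiv.Perm.sameCycle_inv]
  split_ifs <;> simp

omit [Fintype ι] in
theorem iterate_mem_of_mem {σ : Equiv.Perm ι} {J : Finset ι} (h : ∀ i, i ∉ J → σ i = i) {i : ι}
    (hi : i ∈ J) (t : ℕ) : σ^[t] i ∈ J := by
  induction t with
  | zero => exact hi
  | succ t ih =>
    rw [Function.iterate_succ_apply']
    by_contra hn
    have := σ.injective (h _ hn)
    rw [this] at hn
    exact hn ih

/-- Removing the cycle through a marked point: the part of the recursion for `permanentSum` where
this cycle has length `m + 1`. -/
theorem sum_marked_le {T : Matrix ι ι ℝ} (hT : ∀ i j, 0 ≤ T i j) (m r : ℕ) :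
    ∑ y ∈ ((partialPerms ι (r + (m + 1))).sigma fun a => a.2).filter
        (fun y => Function.minimalPeriod y.1.1 y.2 = m + 1), ∏ i ∈ y.1.2, T i (y.1.1 i) ≤
      (T ^ (m + 1)).trace * permanentSum T r := by
  set s := ((partialPerms ι (r + (m + 1))).sigma fun a => a.2).filter
        (fun y => Function.minimalPeriod y.1.1 y.2 = m + 1) with hs
  let walk : (Σ _ : Equiv.Perm ι × Finset ι, ι) → Fin (m + 1) → ι := fun y t => (y.1.1)^[t] y.2
  -- The cycle through the marked point becomes a closed walk, the rest a partial permutation of `r`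
  -- points. The map is injective but not onto, as general walks may repeat vertices or meet the
  -- rest; hence an inequality, by nonnegativity of `T`.
  let φ : (Σ _ : Equiv.Perm ι × Finset ι, ι) → (Fin (m + 1) → ι) × (Equiv.Perm ι × Finset ι) :=
    fun y => (walk y, (y.1.1 * (y.1.1.cycleOf y.2)⁻¹, y.1.2 \ Finset.univ.image (walk y)))
  let g : (Fin (m + 1) → ι) × (Equiv.Perm ι × Finset ι) → ℝ :=
    fun z => (∏ t, T (z.1 t) (z.1 (t + 1))) * ∏ i ∈ z.2.2, T i (z.2.1 i)
  have hmem : ∀ y ∈ s, (y.1.2.card = r + (m + 1) ∧ ∀ i, i ∉ y.1.2 → y.1.1 i = i) ∧ y.2 ∈ y.1.2 ∧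
      Function.minimalPeriod y.1.1 y.2 = m + 1 := fun y hy => by
    rw [hs, Finset.mem_filter, Finset.mem_sigma, mem_partialPerms] at hy
    exact ⟨hy.1.1, hy.1.2, hy.2⟩
  have hwalk_inj : ∀ y ∈ s, Function.Injective (walk y) := fun y hy t u htu => by
    have hp := (hmem y hy).2.2
    have := (Function.iterate_injOn_Iio_minimalPeriod (f := y.1.1) (x := y.2))
      (by rw [hp]; exact t.2) (by rw [hp]; exact u.2) htu
    exact Fin.ext this
  have hsame : ∀ y ∈ s, ∀ x, y.1.1.SameCycle y.2 x ↔ x ∈ Finset.univ.image (walk y) :=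
    fun y hy x => by
      rw [sameCycle_iff_exists_lt_minimalPeriod, (hmem y hy).2.2]
      simp only [Finset.mem_image, Finset.mem_univ, true_and, walk]
      exact ⟨fun ⟨t, ht, h⟩ => ⟨⟨t, ht⟩, h⟩, fun ⟨t, h⟩ => ⟨t, t.2, h⟩⟩
  have hsub : ∀ y ∈ s, Finset.univ.image (walk y) ⊆ y.1.2 := fun y hy => by
    intro x hx
    obtain ⟨t, -, rfl⟩ := Finset.mem_image.1 hx
    exact iterate_mem_of_mem (hmem y hy).1.2 (hmem y hy).2.1 _
  have hstep : ∀ y ∈ s, ∀ t : Fin (m + 1), y.1.1 (walk y t) = walk y (t + 1) := fun y hy t => by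
    simp only [walk]
    rw [← Function.iterate_succ_apply' (⇑y.1.1)]
    refine Fin.lastCases ?_ (fun t => ?_) t
    · have := Function.iterate_minimalPeriod (f := y.1.1) (x := y.2)
      rw [(hmem y hy).2.2] at this
      simpa using this
    · simp
  have hweight : ∀ y ∈ s, ∏ i ∈ y.1.2, T i (y.1.1 i) = g (φ y) := fun y hy => by
    rw [← Finset.prod_sdiff (hsub y hy), mul_comm,
      Finset.prod_image fun t _ u _ h => hwalk_inj y hy h]
    simp only [g, φ]
    congr 1
    · exact Finset.prod_congr rfl fun t _ => by rw [hstep y hy]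
    · refine Finset.prod_congr rfl fun x hx => ?_
      rw [mul_cycleOf_inv_apply, if_neg]
      rw [hsame y hy]
      exact (Finset.mem_sdiff.1 hx).2
  -- The marked point is the start of the walk, the removed points are its image, and the
  -- permutation on them is read off consecutive vertices.
  have hinj : Set.InjOn φ s := fun y hy y' hy' h => by
    have hw : walk y = walk y' := congrArg Prod.fst h
    have hσ : y.1.1 * (y.1.1.cycleOf y.2)⁻¹ = y'.1.1 * (y'.1.1.cycleOf y'.2)⁻¹ :=
      congrArg (fun z => z.2.1) h
    have hJ : y.1.2 \ Finset.univ.image (walk y) = y'.1.2 \ Finset.univ.image (walk y') :=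
      congrArg (fun z => z.2.2) h
    have hi : y.2 = y'.2 := congrFun hw 0
    have hJ' : y.1.2 = y'.1.2 := by
      rw [← Finset.sdiff_union_of_subset (hsub y hy), hJ, hw,
        Finset.sdiff_union_of_subset (hsub y' hy')]
    have hσ' : y.1.1 = y'.1.1 := by
      refine Equiv.ext fun x => ?_
      by_cases hx : x ∈ Finset.univ.image (walk y)
      · obtain ⟨t, -, rfl⟩ := Finset.mem_image.1 hx
        rw [hstep y hy, hw, hstep y' hy']
      · have h1 := mul_cycleOf_inv_apply y.1.1 y.2 x
        have h2 := mul_cycleOf_inv_apply y'.1.1 y'.2 x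
        rw [if_neg (by rwa [hsame y hy])] at h1
        rw [if_neg (by rwa [hsame y' hy', ← hw])] at h2
        rw [← h1, ← h2, hσ]
    exact Sigma.ext (Prod.ext hσ' hJ') (heq_of_eq hi)
  have hmaps : ∀ y ∈ s, φ y ∈ (Finset.univ : Finset (Fin (m + 1) → ι)) ×ˢ partialPerms ι r :=
    fun y hy => by
      rw [Finset.mem_product, mem_partialPerms]
      refine ⟨Finset.mem_univ _, ?_, fun x hx => ?_⟩
      · simp only [φ]
        rw [Finset.card_sdiff_of_subset (hsub y hy), Finset.card_image_of_injective _
          (hwalk_inj y hy), (hmem y hy).1.1]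
        simp
      · simp only [φ] at hx ⊢
        rw [mul_cycleOf_inv_apply]
        split_ifs with hc
        · rfl
        · refine (hmem y hy).1.2 x fun hxJ => hx (Finset.mem_sdiff.2 ⟨hxJ, ?_⟩)
          rwa [← hsame y hy]
  calc ∑ y ∈ s, ∏ i ∈ y.1.2, T i (y.1.1 i) = ∑ z ∈ s.image φ, g z := by
        rw [Finset.sum_image hinj]
        exact Finset.sum_congr rfl hweight
    _ ≤ ∑ z ∈ (Finset.univ : Finset (Fin (m + 1) → ι)) ×ˢ partialPerms ι r, g z :=
        Finset.sum_le_sum_of_subset_of_nonneg (Finset.image_subset_iff.2 hmaps) fun z _ _ =>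
          mul_nonneg (Finset.prod_nonneg fun _ _ => hT _ _) (Finset.prod_nonneg fun _ _ => hT _ _)
    _ = _ := by
        rw [trace_pow_eq_sum_closedWalks, permanentSum, Finset.sum_mul_sum, Finset.sum_product]

/-- Newton type inequality for the principal permanent sums. -/
theorem succ_mul_permanentSum_le {T : Matrix ι ι ℝ} (hT : ∀ i j, 0 ≤ T i j) (k : ℕ) :
    ((k : ℝ) + 1) * permanentSum T (k + 1) ≤
      ∑ i ∈ Finset.range (k + 1), (T ^ (k + 1 - i)).trace * permanentSum T i := by
  -- The factor `k + 1` counts the choices of a marked point.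
  have h1 : ((k : ℝ) + 1) * permanentSum T (k + 1) =
      ∑ y ∈ (partialPerms ι (k + 1)).sigma fun a => a.2, ∏ i ∈ y.1.2, T i (y.1.1 i) := by
    rw [Finset.sum_sigma, permanentSum, Finset.mul_sum]
    refine Finset.sum_congr rfl fun a ha => ?_
    dsimp only
    rw [Finset.sum_const, (mem_partialPerms.1 ha).1, nsmul_eq_mul]
    push_cast
    rfl
  have hper : ∀ y ∈ (partialPerms ι (k + 1)).sigma fun a => a.2,
      0 < Function.minimalPeriod y.1.1 y.2 ∧ Function.minimalPeriod y.1.1 y.2 ≤ k + 1 := by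
    intro y hy
    obtain ⟨h2, h3⟩ := Finset.mem_sigma.1 hy
    rw [mem_partialPerms] at h2
    refine ⟨Function.minimalPeriod_pos_of_mem_periodicPts (y.1.1.injective.mem_periodicPts _), ?_⟩
    rw [← h2.1, ← Finset.card_range (Function.minimalPeriod y.1.1 y.2)]
    refine Finset.card_le_card_of_injOn (fun t => y.1.1^[t] y.2)
      (fun t _ => iterate_mem_of_mem h2.2 h3 t) fun t ht u hu h => ?_
    exact Function.iterate_injOn_Iio_minimalPeriod (by simpa using ht) (by simpa using hu) h
  -- Terms are sorted by the number of points left once the marked cycle is removed.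
  rw [h1, ← Finset.sum_fiberwise_of_maps_to (t := Finset.range (k + 1))
    (g := fun y => k + 1 - Function.minimalPeriod y.1.1 y.2)
    (fun y hy => by have := hper y hy; simp only [Finset.mem_range]; omega)]
  refine Finset.sum_le_sum fun i hi => ?_
  have hi' := Finset.mem_range.1 hi
  have h2 := sum_marked_le hT (k - i) i
  have e1 : i + (k - i + 1) = k + 1 := by omega
  have e2 : k - i + 1 = k + 1 - i := by omega
  rw [e1, e2] at h2
  refine le_trans (le_of_eq ?_) h2
  congr 1
  refine Finset.filter_congr fun y hy => ?_
  have := hper y hy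
  omega

theorem permanentSum_le_negBinomCoeff {T : Matrix ι ι ℝ} (hT : ∀ i j, 0 ≤ T i j) {B : ℕ} {q : ℝ}
    (hq : 0 ≤ q) (htr : ∀ j, 1 ≤ j → (T ^ j).trace ≤ ((B + 1 : ℕ) : ℝ) * q ^ j) (k : ℕ) :
    permanentSum T k ≤ negBinomCoeff B q k :=
  le_negBinomCoeff_of_recursion (K := k) hq (permanentSum_nonneg hT) (permanentSum_zero T).le
    (fun j hj _ => htr j hj) (fun k _ => succ_mul_permanentSum_le hT k) k le_rfl

end CycleRemoval

/-! ### Invariance of the product law under sign changes. -/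

section SignFlips

variable {κ : Type*} [DecidableEq κ]

/-- Changing the sign of one coordinate. -/
def signFlip (e : κ) (x : κ → ℂ) : κ → ℂ := fun e' => if e' = e then -x e' else x e'

theorem signFlip_involutive (e : κ) : Function.Involutive (signFlip e) := fun x => by
  ext e'
  by_cases h : e' = e <;> simp [signFlip, h]

theorem measurePreserving_signFlip [Fintype κ] {ξ : Measure ℂ} [IsProbabilityMeasure ξ]
    (hsymm : ξ.map (fun z => -z) = ξ) (e : κ) :
    MeasurePreserving (signFlip e) (Measure.pi fun _ : κ => ξ) (Measure.pi fun _ : κ => ξ) := by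
  have := measurePreserving_pi (fun _ : κ => ξ) (fun _ : κ => ξ)
    (f := fun e' z => if e' = e then -z else z) (fun e' => by
      by_cases h : e' = e
      · simp only [h, if_true]
        exact ⟨measurable_neg, hsymm⟩
      · simp only [h, if_false]
        exact MeasurePreserving.id ξ)
  exact this

/-- The flip preserves the product measure, so the integral equals its own negative. No
integrability is needed, because the flip is a measurable equivalence. -/
theorem integral_eq_zero_of_signFlip [Fintype κ] {ξ : Measure ℂ} [IsProbabilityMeasure ξ]
    (hsymm : ξ.map (fun z => -z) = ξ) (e : κ) {F : (κ → ℂ) → ℂ}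
    (hF : ∀ x, F (signFlip e x) = -F x) : ∫ x, F x ∂(Measure.pi fun _ : κ => ξ) = 0 := by
  have hmp := measurePreserving_signFlip hsymm e
  have h := hmp.integral_comp (MeasurableEquiv.ofInvolutive (signFlip e) (signFlip_involutive e)
    hmp.measurable).measurableEmbedding F
  simp only [hF, integral_neg] at h
  exact self_eq_neg.1 h.symm

theorem prod_signFlip {α : Type*} (s : Finset α) (g : α → κ) {φ : ℂ → ℂ} (hφ : ∀ z, φ (-z) = -φ z)
    (e : κ) (x : κ → ℂ) :
    ∏ i ∈ s, φ (signFlip e x (g i)) =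
      (-1) ^ (s.filter fun i => g i = e).card * ∏ i ∈ s, φ (x (g i)) := by
  have : ∀ i ∈ s, φ (signFlip e x (g i)) = (if g i = e then (-1 : ℂ) else 1) * φ (x (g i)) :=
    fun i _ => by by_cases h : g i = e <;> simp [signFlip, h, hφ]
  rw [Finset.prod_congr rfl this, Finset.prod_mul_distrib, Finset.prod_ite]
  simp

end SignFlips

/-! ### Moments of products and orthogonal sums. -/

section ProductMoments

variable {κ : Type*} [Fintype κ] [DecidableEq κ] {ξ : Measure ℂ} [IsProbabilityMeasure ξ]

theorem prod_finset_eq_prod_univ {κ : Type*} [Fintype κ] [DecidableEq κ] (s : Finset κ)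
    (f : ℂ → ℝ) (x : κ → ℂ) :
    ∏ e ∈ s, f (x e) = ∏ e, (if e ∈ s then f else fun _ => 1) (x e) := by
  rw [← Finset.prod_subset (Finset.subset_univ s) fun e _ he => by rw [if_neg he]]
  exact Finset.prod_congr rfl fun e he => by rw [if_pos he]

theorem integral_prod_finset (s : Finset κ) (f : ℂ → ℝ) :
    ∫ x, ∏ e ∈ s, f (x e) ∂(Measure.pi fun _ : κ => ξ) = (∫ z, f z ∂ξ) ^ s.card := by
  simp only [prod_finset_eq_prod_univ s f]
  rw [integral_fintype_prod_eq_prod]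
  have h2 : ∀ e : κ, ∫ z, (if e ∈ s then f else fun _ => 1) z ∂ξ =
      if e ∈ s then ∫ z, f z ∂ξ else 1 := fun e => by split_ifs <;> simp
  simp only [h2]
  rw [Finset.prod_ite_mem, Finset.univ_inter, Finset.prod_const]

theorem integrable_prod_finset (s : Finset κ) {f : ℂ → ℝ} (hf : Integrable f ξ) :
    Integrable (fun x => ∏ e ∈ s, f (x e)) (Measure.pi fun _ : κ => ξ) := by
  simp only [prod_finset_eq_prod_univ s f]
  refine Integrable.fintype_prod (f := fun e : κ => if e ∈ s then f else fun _ => 1) fun e => ?_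
  split_ifs
  · exact hf
  · exact integrable_const _

open ComplexConjugate in
/-- Second moment of a combination of orthogonal random variables. -/
theorem integral_norm_sq_sum_of_orthogonal {Ω α : Type*} [MeasurableSpace Ω] {μ : Measure Ω}
    (s : Finset α) (c : α → ℂ) {y : α → Ω → ℂ} (hy : ∀ a ∈ s, MemLp (y a) 2 μ)
    (horth : ∀ a ∈ s, ∀ b ∈ s, a ≠ b → ∫ x, y a x * conj (y b x) ∂μ = 0) :
    ∫ x, ‖∑ a ∈ s, c a * y a x‖ ^ 2 ∂μ = ∑ a ∈ s, ‖c a‖ ^ 2 * ∫ x, ‖y a x‖ ^ 2 ∂μ := by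
  classical
  have hint : ∀ a ∈ s, ∀ b ∈ s, Integrable (fun x => y a x * conj (y b x)) μ := fun a ha b hb =>
    (hy a ha).integrable_mul (hy b hb).star
  have h1 : ∀ x, ((‖∑ a ∈ s, c a * y a x‖ ^ 2 : ℝ) : ℂ) =
      ∑ a ∈ s, ∑ b ∈ s, (c a * conj (c b)) * (y a x * conj (y b x)) := fun x => by
    push_cast
    rw [← Complex.mul_conj', map_sum, Finset.sum_mul_sum]
    refine Finset.sum_congr rfl fun a _ => Finset.sum_congr rfl fun b _ => ?_
    rw [map_mul]; ring
  have h2 : ((∫ x, ‖∑ a ∈ s, c a * y a x‖ ^ 2 ∂μ : ℝ) : ℂ) =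
      ((∑ a ∈ s, ‖c a‖ ^ 2 * ∫ x, ‖y a x‖ ^ 2 ∂μ : ℝ) : ℂ) := by
    rw [← integral_complex_ofReal]
    simp only [h1]
    rw [integral_finsetSum _ fun a ha => integrable_finsetSum _ fun b hb =>
      (hint a ha b hb).const_mul _]
    push_cast
    refine Finset.sum_congr rfl fun a ha => ?_
    rw [integral_finsetSum _ fun b hb => (hint a ha b hb).const_mul _,
      Finset.sum_eq_single_of_mem a ha]
    · rw [integral_const_mul, Complex.mul_conj', ← integral_complex_ofReal]
      congr 1
      refine integral_congr_ae (Eventually.of_forall fun x => ?_)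
      simp [Complex.mul_conj']
    · intro b hb hba
      rw [integral_const_mul, horth a ha b hb hba.symm, mul_zero]
  exact_mod_cast h2

end ProductMoments

/-! ### Truncation of the entries. -/

section Truncation

/-- Truncation of a complex number at modulus `M`. -/
noncomputable def truncate (M : ℝ) (z : ℂ) : ℂ := if ‖z‖ ≤ M then z else 0

theorem truncate_neg (M : ℝ) (z : ℂ) : truncate M (-z) = -truncate M z := by
  by_cases h : ‖z‖ ≤ M <;> simp [truncate, h]

theorem measurable_truncate (M : ℝ) : Measurable (truncate M) :=
  Measurable.ite (measurableSet_le measurable_norm measurable_const) measurable_id measurable_const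

theorem norm_truncate_le (M : ℝ) (z : ℂ) : ‖truncate M z‖ ≤ ‖z‖ := by
  by_cases h : ‖z‖ ≤ M <;> simp [truncate, h]

theorem norm_truncate_le_bound {M : ℝ} (hM : 0 ≤ M) (z : ℂ) : ‖truncate M z‖ ≤ M := by
  by_cases h : ‖z‖ ≤ M <;> simp [truncate, h, hM]

variable {ξ : Measure ℂ}

theorem integrable_norm_sq_of_integral_eq_one (hvar : ∫ z, ‖z‖ ^ 2 ∂ξ = 1) :
    Integrable (fun z : ℂ => ‖z‖ ^ 2) ξ := by
  by_contra h
  rw [integral_undef h] at hvar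
  exact zero_ne_one hvar

theorem integrable_norm_sq_truncate (hvar : ∫ z, ‖z‖ ^ 2 ∂ξ = 1) (M : ℝ) :
    Integrable (fun z : ℂ => ‖truncate M z‖ ^ 2) ξ := by
  refine (integrable_norm_sq_of_integral_eq_one hvar).mono'
    ((measurable_truncate M).norm.pow_const 2).aestronglyMeasurable
    (Eventually.of_forall fun z => ?_)
  rw [Real.norm_of_nonneg (by positivity)]
  exact pow_le_pow_left₀ (norm_nonneg _) (norm_truncate_le M z) 2

theorem integral_norm_sq_truncate_le_one (hvar : ∫ z, ‖z‖ ^ 2 ∂ξ = 1) (M : ℝ) :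
    ∫ z, ‖truncate M z‖ ^ 2 ∂ξ ≤ 1 := by
  rw [← hvar]
  exact integral_mono (integrable_norm_sq_truncate hvar M)
    (integrable_norm_sq_of_integral_eq_one hvar)
    fun z => pow_le_pow_left₀ (norm_nonneg _) (norm_truncate_le M z) 2

theorem tendsto_integral_norm_sq_truncate (hvar : ∫ z, ‖z‖ ^ 2 ∂ξ = 1) :
    Tendsto (fun M : ℕ => ∫ z, ‖truncate M z‖ ^ 2 ∂ξ) atTop (𝓝 1) := by
  rw [← hvar]
  refine tendsto_integral_of_dominated_convergence (fun z => ‖z‖ ^ 2)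
    (fun M => ((measurable_truncate M).norm.pow_const 2).aestronglyMeasurable)
    (integrable_norm_sq_of_integral_eq_one hvar) (fun M => Eventually.of_forall fun z => ?_)
    (Eventually.of_forall fun z => ?_)
  · rw [Real.norm_of_nonneg (by positivity)]
    exact pow_le_pow_left₀ (norm_nonneg _) (norm_truncate_le M z) 2
  · refine tendsto_const_nhds.congr' ?_
    filter_upwards [eventually_ge_atTop ⌈‖z‖⌉₊] with M hM
    have : ‖z‖ ≤ M := (Nat.le_ceil _).trans (by exact_mod_cast hM)
    simp [truncate, this]

end Truncation

/-! ### Second moments of the coefficients of `det (1 - z A)`. -/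

section CoefficientMoments

variable {ι : Type*} [Fintype ι] [DecidableEq ι]

/-- The monomial of a partial permutation, with each entry transformed by `φ`. -/
def permMonomial (φ : ℂ → ℂ) (a : Equiv.Perm ι × Finset ι) (x : ι × ι → ℂ) : ℂ :=
  ∏ i ∈ a.2, φ (x (i, a.1 i))

omit [Fintype ι] in
theorem permMonomial_signFlip {φ : ℂ → ℂ} (hφ : ∀ z, φ (-z) = -φ z)
    (a : Equiv.Perm ι × Finset ι) (e : ι × ι) (x : ι × ι → ℂ) :
    permMonomial φ a (signFlip e x) =
      (if e.1 ∈ a.2 ∧ a.1 e.1 = e.2 then -1 else 1) * permMonomial φ a x := by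
  rw [permMonomial, prod_signFlip a.2 (fun i => (i, a.1 i)) hφ, permMonomial]
  congr 1
  split_ifs with h
  · have : a.2.filter (fun i => (i, a.1 i) = e) = {e.1} := by
      ext i
      simp only [Finset.mem_filter, Finset.mem_singleton, Prod.ext_iff]
      constructor
      · exact fun hi => hi.2.1
      · rintro rfl
        exact ⟨h.1, rfl, h.2⟩
    simp [this]
  · have : a.2.filter (fun i => (i, a.1 i) = e) = ∅ := by
      refine Finset.filter_eq_empty_iff.2 fun i hi he => h ?_
      rw [← he]
      exact ⟨hi, rfl⟩
    simp [this]

/-- Distinct partial permutations use different sets of entries. -/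
theorem exists_entry_of_ne {k : ℕ} {a b : Equiv.Perm ι × Finset ι} (ha : a ∈ partialPerms ι k)
    (hb : b ∈ partialPerms ι k) (hab : a ≠ b) :
    ∃ e : ι × ι, ¬((e.1 ∈ a.2 ∧ a.1 e.1 = e.2) ↔ (e.1 ∈ b.2 ∧ b.1 e.1 = e.2)) := by
  by_contra hcon
  push Not at hcon
  refine hab ?_
  have hJ : a.2 = b.2 := by
    ext i
    exact ⟨fun hi => ((hcon (i, a.1 i)).1 ⟨hi, rfl⟩).1, fun hi => ((hcon (i, b.1 i)).2 ⟨hi, rfl⟩).1⟩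
  refine Prod.ext (Equiv.ext fun i => ?_) hJ
  by_cases hi : i ∈ a.2
  · exact (((hcon (i, a.1 i)).1 ⟨hi, rfl⟩).2).symm
  · rw [(mem_partialPerms.1 ha).2 i hi, (mem_partialPerms.1 hb).2 i (hJ ▸ hi)]

omit [Fintype ι] in
theorem norm_sq_permMonomial (φ : ℂ → ℂ) (a : Equiv.Perm ι × Finset ι) (x : ι × ι → ℂ) :
    ‖permMonomial φ a x‖ ^ 2 = ∏ e ∈ a.2.image fun i => (i, a.1 i), ‖φ (x e)‖ ^ 2 := by
  rw [Finset.prod_image fun i _ j _ h => congrArg Prod.fst h, permMonomial, norm_prod,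
    Finset.prod_pow]

omit [Fintype ι] in
theorem card_entries (a : Equiv.Perm ι × Finset ι) :
    (a.2.image fun i => (i, a.1 i)).card = a.2.card :=
  Finset.card_image_of_injective _ fun _ _ h => congrArg Prod.fst h

omit [Fintype ι] [DecidableEq ι] in
theorem measurable_permMonomial {φ : ℂ → ℂ} (hφ : Measurable φ) (a : Equiv.Perm ι × Finset ι) :
    Measurable (permMonomial φ a) :=
  Finset.measurable_prod _ fun _ _ => hφ.comp (measurable_pi_apply _)

/-- Truncation either leaves the whole monomial unchanged or kills it. -/
theorem norm_sq_permMonomial_sub_truncate (M : ℝ) (a : Equiv.Perm ι × Finset ι) (x : ι × ι → ℂ) :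
    ‖permMonomial id a x - permMonomial (truncate M) a x‖ ^ 2 =
      ‖permMonomial id a x‖ ^ 2 - ‖permMonomial (truncate M) a x‖ ^ 2 := by
  by_cases h : ∀ i ∈ a.2, ‖x (i, a.1 i)‖ ≤ M
  · have : permMonomial (truncate M) a x = permMonomial id a x :=
      Finset.prod_congr rfl fun i hi => by simp [truncate, h i hi]
    simp [this]
  · push Not at h
    obtain ⟨i, hi, hM⟩ := h
    have : permMonomial (truncate M) a x = 0 :=
      Finset.prod_eq_zero hi (by simp [truncate, hM])
    simp [this]

variable {ξ : Measure ℂ} [IsProbabilityMeasure ξ]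

theorem memLp_permMonomial {φ : ℂ → ℂ} (hφ : Measurable φ)
    (hint : Integrable (fun z => ‖φ z‖ ^ 2) ξ) (a : Equiv.Perm ι × Finset ι) :
    MemLp (permMonomial φ a) 2 (Measure.pi fun _ : ι × ι => ξ) := by
  rw [memLp_two_iff_integrable_sq_norm (measurable_permMonomial hφ a).aestronglyMeasurable]
  simp only [norm_sq_permMonomial]
  exact integrable_prod_finset _ hint

theorem integral_norm_sq_permMonomial (φ : ℂ → ℂ) (a : Equiv.Perm ι × Finset ι) :
    ∫ x, ‖permMonomial φ a x‖ ^ 2 ∂(Measure.pi fun _ : ι × ι => ξ) =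
      (∫ z, ‖φ z‖ ^ 2 ∂ξ) ^ a.2.card := by
  simp only [norm_sq_permMonomial]
  rw [integral_prod_finset _ (fun z => ‖φ z‖ ^ 2), card_entries]

open ComplexConjugate in
-- Some entry is used by exactly one of `a` and `b`, and flipping its sign makes the product odd.
-- The family `y` is abstract so that the lemma also covers differences with truncated monomials.
theorem integral_mul_conj_eq_zero_of_signFlip (hsymm : ξ.map (fun z => -z) = ξ) {k : ℕ}
    {y : Equiv.Perm ι × Finset ι → (ι × ι → ℂ) → ℂ}
    (hflip : ∀ a e x, y a (signFlip e x) = (if e.1 ∈ a.2 ∧ a.1 e.1 = e.2 then -1 else 1) * y a x)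
    {a b : Equiv.Perm ι × Finset ι} (ha : a ∈ partialPerms ι k)
    (hb : b ∈ partialPerms ι k) (hab : a ≠ b) :
    ∫ x, y a x * conj (y b x) ∂(Measure.pi fun _ : ι × ι => ξ) = 0 := by
  obtain ⟨e, he⟩ := exists_entry_of_ne ha hb hab
  refine integral_eq_zero_of_signFlip hsymm e fun x => ?_
  rw [hflip, hflip]
  by_cases h1 : e.1 ∈ a.2 ∧ a.1 e.1 = e.2 <;> by_cases h2 : e.1 ∈ b.2 ∧ b.1 e.1 = e.2
  · exact absurd (iff_of_true h1 h2) he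
  · rw [if_pos h1, if_neg h2]; simp
  · rw [if_neg h1, if_pos h2]; simp
  · exact absurd (iff_of_false h1 h2) he

theorem coeff_charpolyRev_weightedMatrix {n : ℕ} (b : Matrix (Fin n) (Fin n) ℝ) (φ : ℂ → ℂ)
    (x : Fin n × Fin n → ℂ) (k : ℕ) :
    (weightedMatrix b fun i j => φ (x (i, j))).charpolyRev.coeff k =
      ∑ a ∈ partialPerms (Fin n) k,
        ((-1) ^ k * ((Equiv.Perm.sign a.1 : ℤ) : ℂ) * ∏ i ∈ a.2, (b i (a.1 i) : ℂ)) *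
          permMonomial φ a x := by
  rw [coeff_charpolyRev]
  refine Finset.sum_congr rfl fun a _ => ?_
  simp only [weightedMatrix, Matrix.of_apply, permMonomial]
  rw [Finset.prod_mul_distrib]
  ring

theorem norm_sq_sign_mul_prod {n : ℕ} (b : Matrix (Fin n) (Fin n) ℝ)
    (a : Equiv.Perm (Fin n) × Finset (Fin n)) (k : ℕ) :
    ‖(-1) ^ k * ((Equiv.Perm.sign a.1 : ℤ) : ℂ) * ∏ i ∈ a.2, (b i (a.1 i) : ℂ)‖ ^ 2 =
      ∏ i ∈ a.2, varianceProfile b i (a.1 i) := by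
  have h : ‖((Equiv.Perm.sign a.1 : ℤ) : ℂ)‖ = 1 := by
    rcases Int.units_eq_one_or (Equiv.Perm.sign a.1) with h | h <;> simp [h]
  rw [norm_mul, norm_mul, h, norm_pow, norm_neg, norm_one, one_pow, one_mul, one_mul, norm_prod,
    ← Finset.prod_pow]
  simp [varianceProfile]

variable {n : ℕ} (b : Matrix (Fin n) (Fin n) ℝ)

theorem integral_norm_sq_coeff (hsymm : ξ.map (fun z => -z) = ξ)
    (hvar : ∫ z, ‖z‖ ^ 2 ∂ξ = 1) (k : ℕ) :
    ∫ x, ‖(weightedMatrix b fun i j => x (i, j)).charpolyRev.coeff k‖ ^ 2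
      ∂(Measure.pi fun _ : Fin n × Fin n => ξ) = permanentSum (varianceProfile b) k := by
  have h := fun x => coeff_charpolyRev_weightedMatrix b id x k
  simp only [id] at h
  simp only [h]
  rw [integral_norm_sq_sum_of_orthogonal _ _
    (fun a _ => memLp_permMonomial measurable_id (integrable_norm_sq_of_integral_eq_one hvar) a)
    (fun a ha c hc hac => integral_mul_conj_eq_zero_of_signFlip hsymm
      (permMonomial_signFlip (φ := id) fun _ => rfl) ha hc hac)]
  refine Finset.sum_congr rfl fun a _ => ?_
  rw [norm_sq_sign_mul_prod, integral_norm_sq_permMonomial]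
  simp [hvar]

/-- What matters is that the relative error depends on `M` and `k` only, not on `n` or `b`. -/
theorem integral_norm_sq_coeff_sub_truncate (hsymm : ξ.map (fun z => -z) = ξ)
    (hvar : ∫ z, ‖z‖ ^ 2 ∂ξ = 1) (M : ℝ) (k : ℕ) :
    ∫ x, ‖(weightedMatrix b fun i j => x (i, j)).charpolyRev.coeff k -
        (weightedMatrix b fun i j => truncate M (x (i, j))).charpolyRev.coeff k‖ ^ 2
      ∂(Measure.pi fun _ : Fin n × Fin n => ξ) =
      permanentSum (varianceProfile b) k * (1 - (∫ z, ‖truncate M z‖ ^ 2 ∂ξ) ^ k) := by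
  have h1 := fun x => coeff_charpolyRev_weightedMatrix b id x k
  simp only [id] at h1
  have h2 := fun x => coeff_charpolyRev_weightedMatrix b (truncate M) x k
  have hL1 : ∀ a, MemLp (permMonomial id a) 2 (Measure.pi fun _ : Fin n × Fin n => ξ) := fun a =>
    memLp_permMonomial measurable_id (integrable_norm_sq_of_integral_eq_one hvar) a
  have hL2 : ∀ a, MemLp (permMonomial (truncate M) a) 2
      (Measure.pi fun _ : Fin n × Fin n => ξ) := fun a =>
    memLp_permMonomial (measurable_truncate M) (integrable_norm_sq_truncate hvar M) a
  simp only [h1, h2, ← Finset.sum_sub_distrib, ← mul_sub]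
  rw [integral_norm_sq_sum_of_orthogonal (y := fun a x => permMonomial id a x -
      permMonomial (truncate M) a x) _ _ (fun a _ => (hL1 a).sub (hL2 a))
    (fun a ha c hc hac => integral_mul_conj_eq_zero_of_signFlip hsymm
      (y := fun a x => permMonomial id a x - permMonomial (truncate M) a x) (fun a e x => by
      rw [permMonomial_signFlip (φ := id) fun _ => rfl,
        permMonomial_signFlip (truncate_neg M), mul_sub])
      ha hc hac), permanentSum, Finset.sum_mul]
  refine Finset.sum_congr rfl fun a ha => ?_
  rw [norm_sq_sign_mul_prod]
  congr 1
  simp only [norm_sq_permMonomial_sub_truncate]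
  rw [integral_sub ((hL1 a).integrable_norm_pow two_ne_zero)
    ((hL2 a).integrable_norm_pow two_ne_zero), integral_norm_sq_permMonomial,
    integral_norm_sq_permMonomial, (mem_partialPerms.1 ha).1]
  simp [hvar]

end CoefficientMoments

/-! ### Pairs of closed walks using every entry an even number of times. -/

section WalkCombinatorics

/-- Each edge used is used at least twice by the `2 * k` steps, so there are at most `k` edges; they
have at least `k` starting vertices. Equality holds throughout: every edge is used exactly twice and
is determined by its starting vertex. -/
theorem visited_twice_of_even {V ι : Type*} [Fintype V] [DecidableEq ι] {s : V → V}
    {w : V → ι} {k : ℕ} (hV : Fintype.card V = 2 * k)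
    (heven : ∀ e : ι × ι, Even (Finset.univ.filter fun a => (w a, w (s a)) = e).card)
    (himg : k ≤ (Finset.univ.image w).card) (a : V) :
    (Finset.univ.filter fun a' => w a' = w a).card = 2 ∧
      (∀ a', w a' = w a → w (s a') = w (s a)) := by
  set E := Finset.univ.image fun a => (w a, w (s a)) with hE
  have hfib : ∀ e ∈ E, 2 ≤ (Finset.univ.filter fun a => (w a, w (s a)) = e).card := fun e he => by
    obtain ⟨a, -, ha⟩ := Finset.mem_image.1 he
    have hpos : 0 < (Finset.univ.filter fun a => (w a, w (s a)) = e).card :=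
      Finset.card_pos.2 ⟨a, by simpa using ha⟩
    obtain ⟨r, hr⟩ := heven e
    omega
  have hsum : ∑ e ∈ E, (Finset.univ.filter fun a => (w a, w (s a)) = e).card = 2 * k := by
    rw [← hV, ← Finset.card_univ]
    exact (Finset.card_eq_sum_card_fiberwise fun a _ => Finset.mem_coe.2
      (Finset.mem_image_of_mem _ (Finset.mem_univ a))).symm
  have hfst : E.image Prod.fst = Finset.univ.image w := by
    rw [hE, Finset.image_image]; rfl
  have hle : E.card ≤ k := by
    have := Finset.sum_le_sum hfib
    rw [hsum, Finset.sum_const, smul_eq_mul] at this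
    omega
  have hle' : (Finset.univ.image w).card ≤ E.card := hfst ▸ Finset.card_image_le
  have hEk : E.card = k := by omega
  have hinj : Set.InjOn Prod.fst (E : Set (ι × ι)) :=
    Finset.card_image_iff.1 (by rw [hfst]; omega)
  have htwo : ∀ e ∈ E, 2 = (Finset.univ.filter fun a => (w a, w (s a)) = e).card :=
    (Finset.sum_eq_sum_iff_of_le hfib).1
      (by rw [hsum, Finset.sum_const, hEk, smul_eq_mul, mul_comm])
  have hmem : ∀ a, (w a, w (s a)) ∈ E := fun a => Finset.mem_image_of_mem _ (Finset.mem_univ a)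
  have hnext : ∀ a', w a' = w a → w (s a') = w (s a) := fun a' h =>
    congrArg Prod.snd (hinj (hmem a') (hmem a) h)
  refine ⟨?_, hnext⟩
  rw [htwo _ (hmem a)]
  congr 1
  refine Finset.filter_congr fun a' _ => ?_
  rw [Prod.mk.injEq]
  exact ⟨fun h => ⟨h, hnext a' h⟩, fun h => h.1⟩

/-- The number of functions with few values. -/
theorem card_filter_card_image_le {V ι : Type*} [Fintype V] [Nonempty V] [Fintype ι]
    [DecidableEq V] [DecidableEq ι] (m : ℕ) :
    (Finset.univ.filter fun w : V → ι => (Finset.univ.image w).card ≤ m).card ≤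
      m ^ Fintype.card V * Fintype.card ι ^ m := by
  have h : Fintype.card ((V → Fin m) × (Fin m → ι)) = m ^ Fintype.card V * Fintype.card ι ^ m := by
    simp
  rw [← h, ← Finset.card_univ]
  -- A function with at most `m` values factors through `Fin m`.
  refine Finset.card_le_card_of_surjOn (fun p v => p.2 (p.1 v)) fun w hw => ?_
  have hw' : (Finset.univ.image w).card ≤ m := by simpa using hw
  obtain ⟨f⟩ : Nonempty ({i // i ∈ Finset.univ.image w} ↪ Fin m) :=
    Function.Embedding.nonempty_of_card_le (by rw [Fintype.card_coe, Fintype.card_fin]; exact hw')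
  have hv : ∀ v, w v ∈ Finset.univ.image w := fun v => Finset.mem_image_of_mem _ (Finset.mem_univ v)
  set g : Fin m → ι := Function.extend f Subtype.val fun _ => w (Classical.arbitrary V) with hg
  have hgf : ∀ v, g (f ⟨w v, hv v⟩) = w v := fun v => by rw [hg, f.injective.extend_apply]
  exact ⟨(fun v => f ⟨w v, hv v⟩, g), by simp, funext hgf⟩

variable {ι : Type*} {m : ℕ}

/-- Successors depend on the vertex alone, so one coincidence propagates along the walks. -/
theorem eq_shift_of_eq {γ γ' : Fin (m + 1) → ι} {s u : Fin (m + 1)}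
    (hnext : ∀ t t', γ' t' = γ t → γ' (t' + 1) = γ (t + 1)) (h : γ' s = γ u) (t : Fin (m + 1)) :
    γ' (s + t) = γ (u + t) := by
  refine Fin.induction (motive := fun t => γ' (s + t) = γ (u + t)) ?_ (fun t ih => ?_) t
  · simpa using h
  · have := hnext _ _ ih
    rwa [add_assoc, add_assoc, Fin.coeSucc_eq_succ] at this

/-- A closed walk that runs twice through a closed walk of half its length. -/
def IsDoubled (γ : Fin (m + 1) → ι) : Prop :=
  ∃ s : Fin (m + 1), s ≠ 0 ∧ s + s = 0 ∧ ∀ t, γ (s + t) = γ t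

/-- Two closed walks that together visit every vertex exactly twice, each time with the same
successor. -/
def IsTwicePair [DecidableEq ι] (γ γ' : Fin (m + 1) → ι) : Prop :=
  ∀ a : Fin (m + 1) ⊕ Fin (m + 1),
    (Finset.univ.filter fun a' => Sum.elim γ γ' a' = Sum.elim γ γ' a).card = 2 ∧
    ∀ a', Sum.elim γ γ' a' = Sum.elim γ γ' a →
      Sum.elim γ γ' (Sum.map (· + 1) (· + 1) a') = Sum.elim γ γ' (Sum.map (· + 1) (· + 1) a)

/-- The starting vertex recurs at times `s` and `s + s`; a third visit is excluded, so `s + s = 0`.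
-/
theorem isDoubled_of_visited_twice [DecidableEq ι] {V : Type*} [Fintype V] [DecidableEq V]
    {w : V → ι} {f : Fin (m + 1) → V} (hf : Function.Injective f) {s : Fin (m + 1)} (hs : s ≠ 0)
    (hcard : (Finset.univ.filter fun a' => w a' = w (f 0)).card = 2)
    (hshift : ∀ t, w (f (s + t)) = w (f t)) : IsDoubled fun t => w (f t) := by
  refine ⟨s, hs, ?_, hshift⟩
  by_contra hss
  have h0 : w (f s) = w (f 0) := by simpa using hshift 0
  have h1 : w (f (s + s)) = w (f 0) := (hshift s).trans h0
  have hsub : ({f 0, f s, f (s + s)} : Finset V) ⊆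
      Finset.univ.filter fun a' => w a' = w (f 0) := by
    intro v hv
    simp only [Finset.mem_insert, Finset.mem_singleton] at hv
    rcases hv with rfl | rfl | rfl <;> simp [h0, h1]
  have h3 : ({f 0, f s, f (s + s)} : Finset V).card = 3 := by
    refine Finset.card_eq_three.2 ⟨f 0, f s, f (s + s), ?_, ?_, ?_, rfl⟩
    · exact fun h => hs (hf h).symm
    · exact fun h => hss (hf h).symm
    · intro h
      have := hf h
      exact hs (by simpa using this)
  have := Finset.card_le_card hsub
  omega

/-- If the walks share a vertex, one is a shift of the other. Otherwise the second visit to each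
starting vertex occurs within the same walk, which is therefore doubled. -/
theorem IsTwicePair.shift_or_doubled [DecidableEq ι] {γ γ' : Fin (m + 1) → ι}
    (h : IsTwicePair γ γ') :
    (∃ s, ∀ t, γ' t = γ (t - s)) ∨ (IsDoubled γ ∧ IsDoubled γ') := by
  have hex : ∀ a : Fin (m + 1) ⊕ Fin (m + 1), ∃ a', a' ≠ a ∧
      Sum.elim γ γ' a' = Sum.elim γ γ' a := fun a => by
    obtain ⟨a', ha', hne⟩ := Finset.exists_mem_ne (by rw [(h a).1]; norm_num) a
    exact ⟨a', hne, (Finset.mem_filter.1 ha').2⟩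
  have hshift : (∃ s u, γ' s = γ u) → ∃ s, ∀ t, γ' t = γ (t - s) := by
    rintro ⟨s, u, hsu⟩
    refine ⟨s - u, fun t => ?_⟩
    have := eq_shift_of_eq (fun t t' h' => (h (Sum.inl t)).2 (Sum.inr t') h') hsu (t - s)
    rw [add_sub_cancel] at this
    rw [this]
    congr 1
    abel
  by_cases hc : ∃ s u, γ' s = γ u
  · exact Or.inl (hshift hc)
  · right
    push Not at hc
    constructor
    · obtain ⟨a', hne, ha'⟩ := hex (Sum.inl 0)
      rcases a' with s | s
      · refine isDoubled_of_visited_twice (w := Sum.elim γ γ') Sum.inl_injective (s := s)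
          (fun hs => hne (by rw [hs])) (h (Sum.inl 0)).1 fun t => ?_
        have := eq_shift_of_eq (γ := γ) (γ' := γ)
          (fun t t' h' => (h (Sum.inl t)).2 (Sum.inl t') h') (show γ s = γ 0 from ha') t
        simpa using this
      · exact absurd ha' (hc s 0)
    · obtain ⟨a', hne, ha'⟩ := hex (Sum.inr 0)
      rcases a' with s | s
      · exact absurd ha'.symm (hc 0 s)
      · refine isDoubled_of_visited_twice (w := Sum.elim γ γ') Sum.inr_injective (s := s)
          (fun hs => hne (by rw [hs])) (h (Sum.inr 0)).1 fun t => ?_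
        have := eq_shift_of_eq (γ := γ') (γ' := γ')
          (fun t t' h' => (h (Sum.inr t)).2 (Sum.inr t') h') (show γ' s = γ' 0 from ha') t
        simpa using this

end WalkCombinatorics

/-! ### Weights of doubled walks and of twice pairs. -/

section WalkSums

variable {ι : Type*} {m : ℕ}

/-- The product of the absolute values of the weights along a closed walk. -/
def walkWeight (b : Matrix ι ι ℝ) (γ : Fin (m + 1) → ι) : ℝ := ∏ t, |b (γ t) (γ (t + 1))|

theorem walkWeight_nonneg (b : Matrix ι ι ℝ) (γ : Fin (m + 1) → ι) : 0 ≤ walkWeight b γ :=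
  Finset.prod_nonneg fun _ _ => abs_nonneg _

theorem walkWeight_shift (b : Matrix ι ι ℝ) (γ : Fin (m + 1) → ι) (s : Fin (m + 1)) :
    walkWeight b (fun t => γ (t - s)) = walkWeight b γ := by
  rw [walkWeight, walkWeight, ← (Equiv.subRight s).prod_comp (fun t => |b (γ t) (γ (t + 1))|)]
  refine Finset.prod_congr rfl fun t _ => ?_
  simp only [Equiv.subRight_apply]
  rw [add_sub_right_comm]

/-- The weight of a doubled walk is the squared weight of its half. -/
theorem walkWeight_of_periodic (b : Matrix ι ι ℝ) {h : ℕ} {γ : Fin (2 * h + 1 + 1) → ι}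
    (hγ : ∀ t, γ (Fin.ofNat _ (h + 1) + t) = γ t) :
    walkWeight b γ = walkWeight b (fun t : Fin (h + 1) => γ (Fin.ofNat _ t)) ^ 2 := by
  -- Unrolling the walk to a periodic sequence on ℕ turns cyclic products into products over ranges.
  set p : ℕ → ι := fun t => γ (Fin.ofNat _ t) with hp
  have hper : Function.Periodic p (h + 1) := fun t => by
    rw [hp]
    dsimp only
    rw [← hγ (Fin.ofNat _ t)]
    congr 1
    ext
    simp [Fin.val_add, add_comm]
  set g : ℕ → ℝ := fun t => |b (p t) (p (t + 1))| with hg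
  have hwhole : walkWeight b γ = ∏ t ∈ Finset.range (2 * h + 1 + 1), g t := by
    rw [Finset.prod_range, walkWeight]
    refine Finset.prod_congr rfl fun t _ => ?_
    have h1 : p t = γ t := by
      rw [hp]; dsimp only; congr 1; ext; simp
    have h2 : p (t + 1) = γ (t + 1) := by
      rw [hp]; dsimp only; congr 1
    rw [hg]
    dsimp only
    rw [h1, h2]
  have hhalf : walkWeight b (fun t : Fin (h + 1) => p t) = ∏ t ∈ Finset.range (h + 1), g t := by
    rw [Finset.prod_range, walkWeight]
    refine Finset.prod_congr rfl fun t _ => ?_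
    have h2 : p ((t + 1 : Fin (h + 1)) : ℕ) = p (t + 1) := by
      rw [← hper.map_mod_nat (t + 1)]
      congr 1
      simp [Fin.val_add]
    rw [h2]
  have hsplit : 2 * h + 1 + 1 = (h + 1) + (h + 1) := by ring
  rw [hwhole, hhalf, hsplit, Finset.prod_range_add, sq]
  congr 1
  refine Finset.prod_congr rfl fun t _ => ?_
  have h1 : p (h + 1 + t) = p t := by rw [add_comm]; exact hper t
  have h2 : p (h + 1 + t + 1) = p (t + 1) := by
    rw [add_assoc, add_comm]; exact hper (t + 1)
  rw [hg]
  dsimp only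
  rw [h1, h2]

variable [Fintype ι] [DecidableEq ι]

theorem sum_walkWeight_sq (b : Matrix ι ι ℝ) (m : ℕ) :
    ∑ γ : Fin (m + 1) → ι, walkWeight b γ ^ 2 =
      ((Matrix.of fun i j => b i j ^ 2) ^ (m + 1)).trace := by
  rw [trace_pow_eq_sum_closedWalks]
  refine Finset.sum_congr rfl fun γ _ => ?_
  rw [walkWeight, ← Finset.prod_pow]
  simp

variable {b : Matrix ι ι ℝ} {D θ : ℝ}

/-- A doubled walk is determined by its half and weighs the square of it, so the sum is at most the
trace of the profile to the power `(m + 1) / 2`. -/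
theorem sum_walkWeight_doubled_le (hD : 0 ≤ D) (hθ : 0 ≤ θ)
    (htr : ∀ j, 1 ≤ j → ((Matrix.of fun i j => b i j ^ 2) ^ j).trace ≤ D * θ ^ (2 * j))
    (G : Finset (Fin (m + 1) → ι)) (hG : ∀ γ ∈ G, IsDoubled γ) :
    ∑ γ ∈ G, walkWeight b γ ≤ D * θ ^ (m + 1) := by
  by_cases hm : ∃ h, m = 2 * h + 1
  · obtain ⟨h, rfl⟩ := hm
    have hper : ∀ γ ∈ G, ∀ t, γ (Fin.ofNat _ (h + 1) + t) = γ t := fun γ hγ t => by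
      obtain ⟨s, hs, hss, hshift⟩ := hG γ hγ
      -- Modulo `2 * h + 2`, the only nonzero solution of `s + s = 0` is `h + 1`.
      have : s = Fin.ofNat _ (h + 1) := by
        have h1 : s.val ≠ 0 := fun h0 => hs (Fin.ext (by simpa using h0))
        have h2 : (s.val + s.val) % (2 * h + 1 + 1) = 0 := by
          have := congrArg Fin.val hss
          simpa [Fin.val_add] using this
        have h3 := s.2
        have h4 : s.val + s.val = 2 * h + 1 + 1 := by
          obtain ⟨c, hc⟩ := Nat.dvd_of_mod_eq_zero h2
          have : c = 1 := by
            rcases c with _ | _ | c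
            · omega
            · rfl
            · nlinarith
          rw [hc, this, mul_one]
        ext
        rw [Fin.val_ofNat, Nat.mod_eq_of_lt (by omega)]
        omega
      rw [← this]
      exact hshift t
    set ψ : (Fin (2 * h + 1 + 1) → ι) → (Fin (h + 1) → ι) := fun γ t => γ (Fin.ofNat _ t) with hψ
    have hinj : Set.InjOn ψ G := fun γ hγ γ' hγ' he => by
      funext t
      have hval : ∀ δ ∈ G, δ t = ψ δ (Fin.ofNat _ t) := fun δ hδ => by
        have h3 := t.2
        rw [hψ]
        dsimp only
        rcases lt_or_ge t.val (h + 1) with hlt | hge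
        · congr 1
          ext
          simp [Nat.mod_eq_of_lt hlt]
        · refine Eq.trans ?_ (hper δ hδ _)
          congr 1
          ext
          have e1 : t.val % (h + 1) = t.val - (h + 1) := by
            rw [Nat.mod_eq_sub_mod hge, Nat.mod_eq_of_lt (by omega)]
          simp only [Fin.val_add, Fin.val_ofNat, e1]
          rw [Nat.mod_eq_of_lt (a := h + 1) (by omega),
            Nat.mod_eq_of_lt (a := t.val - (h + 1)) (by omega), Nat.mod_eq_of_lt (by omega)]
          omega
      rw [hval γ hγ, hval γ' hγ', he]
    calc ∑ γ ∈ G, walkWeight b γ = ∑ δ ∈ G.image ψ, walkWeight b δ ^ 2 := by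
          rw [Finset.sum_image hinj]
          exact Finset.sum_congr rfl fun γ hγ => walkWeight_of_periodic b (hper γ hγ)
      _ ≤ ∑ δ : Fin (h + 1) → ι, walkWeight b δ ^ 2 :=
          Finset.sum_le_sum_of_subset_of_nonneg (Finset.subset_univ _) fun _ _ _ => sq_nonneg _
      _ ≤ D * θ ^ (2 * (h + 1)) := by
          rw [sum_walkWeight_sq]
          exact htr (h + 1) (by omega)
      _ = D * θ ^ (2 * h + 1 + 1) := by ring_nf
  -- Modulo an odd number there is no nonzero solution of `s + s = 0`.
  · have hempty : G = ∅ := Finset.eq_empty_of_forall_notMem fun γ hγ => by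
      obtain ⟨s, hs, hss, -⟩ := hG γ hγ
      have h1 : s.val ≠ 0 := fun h0 => hs (Fin.ext (by simpa using h0))
      have h2 : (s.val + s.val) % (m + 1) = 0 := by
        have := congrArg Fin.val hss
        simpa [Fin.val_add] using this
      have h3 := s.2
      obtain ⟨c, hc⟩ := Nat.dvd_of_mod_eq_zero h2
      have : c = 1 := by
        rcases c with _ | _ | c
        · omega
        · rfl
        · nlinarith
      rw [this] at hc
      exact hm ⟨s.val - 1, by omega⟩
    rw [hempty, Finset.sum_empty]
    positivity

/-- Shifted pairs contribute `m + 1` copies of the trace of the `(m + 1)`-st power; pairs of doubled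
walks factor and contribute the term with `D ^ 2`. -/
theorem sum_walkWeight_twicePair_le (hD : 0 ≤ D) (hθ : 0 ≤ θ)
    (htr : ∀ j, 1 ≤ j → ((Matrix.of fun i j => b i j ^ 2) ^ j).trace ≤ D * θ ^ (2 * j))
    (G : Finset ((Fin (m + 1) → ι) × (Fin (m + 1) → ι))) (hG : ∀ p ∈ G, IsTwicePair p.1 p.2) :
    ∑ p ∈ G, walkWeight b p.1 * walkWeight b p.2 ≤
      ((m + 1 : ℕ) * D + D ^ 2) * θ ^ (2 * (m + 1)) := by
  classical
  have hnn : ∀ p : (Fin (m + 1) → ι) × (Fin (m + 1) → ι),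
      0 ≤ walkWeight b p.1 * walkWeight b p.2 :=
    fun p => mul_nonneg (walkWeight_nonneg _ _) (walkWeight_nonneg _ _)
  set G₁ : Finset ((Fin (m + 1) → ι) × (Fin (m + 1) → ι)) :=
    Finset.univ.image fun q : (Fin (m + 1) → ι) × Fin (m + 1) => (q.1, fun t => q.1 (t - q.2))
  set G₂ : Finset (Fin (m + 1) → ι) := Finset.univ.filter IsDoubled
  have hsub : G ⊆ G₁ ∪ G₂ ×ˢ G₂ := fun p hp => by
    rcases (hG p hp).shift_or_doubled with ⟨s, hs⟩ | ⟨h1, h2⟩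
    · refine Finset.mem_union_left _ (Finset.mem_image.2 ⟨(p.1, s), Finset.mem_univ _, ?_⟩)
      exact Prod.ext rfl (funext fun t => (hs t).symm)
    · exact Finset.mem_union_right _ (by simp [G₂, h1, h2])
  have h1 : ∑ p ∈ G₁, walkWeight b p.1 * walkWeight b p.2 ≤
      (m + 1 : ℕ) * D * θ ^ (2 * (m + 1)) := by
    calc ∑ p ∈ G₁, walkWeight b p.1 * walkWeight b p.2
        ≤ ∑ q : (Fin (m + 1) → ι) × Fin (m + 1),
            walkWeight b q.1 * walkWeight b (fun t => q.1 (t - q.2)) :=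
          Finset.sum_image_le_of_nonneg (fun p _ => hnn p)
      _ = ((m + 1 : ℕ) : ℝ) * ∑ γ : Fin (m + 1) → ι, walkWeight b γ ^ 2 := by
          rw [Fintype.sum_prod_type, Finset.mul_sum]
          refine Finset.sum_congr rfl fun γ _ => ?_
          simp only [walkWeight_shift]
          rw [Finset.sum_const, Finset.card_univ, Fintype.card_fin, nsmul_eq_mul, sq]
      _ ≤ _ := by
          rw [sum_walkWeight_sq, mul_assoc]
          exact mul_le_mul_of_nonneg_left (htr (m + 1) (by omega)) (by positivity)
  have h2 : ∑ p ∈ G₂ ×ˢ G₂, walkWeight b p.1 * walkWeight b p.2 ≤ D ^ 2 * θ ^ (2 * (m + 1)) := by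
    rw [Finset.sum_product, ← Finset.sum_mul_sum]
    have h := sum_walkWeight_doubled_le hD hθ htr G₂ fun γ hγ => (Finset.mem_filter.1 hγ).2
    have h0 : 0 ≤ ∑ γ ∈ G₂, walkWeight b γ := Finset.sum_nonneg fun _ _ => walkWeight_nonneg _ _
    calc _ ≤ (D * θ ^ (m + 1)) * (D * θ ^ (m + 1)) := mul_le_mul h h h0 (by positivity)
      _ = _ := by ring
  calc ∑ p ∈ G, walkWeight b p.1 * walkWeight b p.2
      ≤ ∑ p ∈ G₁ ∪ G₂ ×ˢ G₂, walkWeight b p.1 * walkWeight b p.2 :=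
        Finset.sum_le_sum_of_subset_of_nonneg hsub fun p _ _ => hnn p
    _ ≤ ∑ p ∈ G₁, walkWeight b p.1 * walkWeight b p.2 +
        ∑ p ∈ G₂ ×ˢ G₂, walkWeight b p.1 * walkWeight b p.2 := by
        rw [← Finset.sum_union_inter]
        exact le_add_of_nonneg_right (Finset.sum_nonneg fun p _ => hnn p)
    _ ≤ _ := by rw [add_mul]; exact add_le_add h1 h2

end WalkSums

/-! ### Second moment of the trace of a power of the truncated matrix. -/

section TraceMoments

open ComplexConjugate

variable {ι : Type*} {m : ℕ}

/-- The random factor of a closed walk, with each entry transformed by `φ`. -/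
def walkMonomial (φ : ℂ → ℂ) (γ : Fin (m + 1) → ι) (x : ι × ι → ℂ) : ℂ :=
  ∏ t, φ (x (γ t, γ (t + 1)))

/-- The `a`-th entry visited by a pair of closed walks. -/
def pairEntry (γ γ' : Fin (m + 1) → ι) (a : Fin (m + 1) ⊕ Fin (m + 1)) : ι × ι :=
  (Sum.elim γ γ' a, Sum.elim γ γ' (Sum.map (· + 1) (· + 1) a))

theorem norm_walkMonomial_mul_conj (φ : ℂ → ℂ) (γ γ' : Fin (m + 1) → ι) (x : ι × ι → ℂ) :
    ‖walkMonomial φ γ x * conj (walkMonomial φ γ' x)‖ = ∏ a, ‖φ (x (pairEntry γ γ' a))‖ := by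
  rw [norm_mul, RCLike.norm_conj, walkMonomial, walkMonomial, norm_prod, norm_prod,
    Fintype.prod_sum_type]
  rfl

theorem measurable_walkMonomial {φ : ℂ → ℂ} (hφ : Measurable φ) (γ : Fin (m + 1) → ι) :
    Measurable (walkMonomial φ γ) :=
  Finset.measurable_prod _ fun _ _ => hφ.comp (measurable_pi_apply _)

theorem walkMonomial_mul_conj_signFlip [DecidableEq ι] {φ : ℂ → ℂ} (hφ : ∀ z, φ (-z) = -φ z)
    (γ γ' : Fin (m + 1) → ι) (e : ι × ι) (x : ι × ι → ℂ) :
    walkMonomial φ γ (signFlip e x) * conj (walkMonomial φ γ' (signFlip e x)) =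
      (-1) ^ (Finset.univ.filter fun a => pairEntry γ γ' a = e).card *
        (walkMonomial φ γ x * conj (walkMonomial φ γ' x)) := by
  have hcard : (Finset.univ.filter fun a => pairEntry γ γ' a = e).card =
      (Finset.univ.filter fun t => (γ t, γ (t + 1)) = e).card +
        (Finset.univ.filter fun t => (γ' t, γ' (t + 1)) = e).card := by
    rw [Finset.card_filter, Finset.card_filter, Finset.card_filter, Fintype.sum_sum_type]
    rfl
  rw [walkMonomial, walkMonomial, prod_signFlip Finset.univ (fun t => (γ t, γ (t + 1))) hφ,
    prod_signFlip Finset.univ (fun t => (γ' t, γ' (t + 1))) hφ, hcard, pow_add, map_mul]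
  simp only [map_pow, map_neg, map_one]
  rw [walkMonomial, walkMonomial]
  ring

variable [Fintype ι] [DecidableEq ι] {ξ : Measure ℂ} [IsProbabilityMeasure ξ]

omit [DecidableEq ι] in
theorem integrable_walkMonomial_mul_conj {M : ℝ} (hM : 0 ≤ M) (γ γ' : Fin (m + 1) → ι) :
    Integrable (fun x => walkMonomial (truncate M) γ x * conj (walkMonomial (truncate M) γ' x))
      (Measure.pi fun _ : ι × ι => ξ) := by
  refine Integrable.of_bound (C := M ^ (2 * (m + 1))) ?_ (Eventually.of_forall fun x => ?_)
  · have h1 := measurable_walkMonomial (measurable_truncate M) γ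
    have h2 := measurable_walkMonomial (measurable_truncate M) γ'
    exact (h1.mul (Complex.continuous_conj.measurable.comp h2)).aestronglyMeasurable
  · rw [norm_walkMonomial_mul_conj]
    refine (Finset.prod_le_prod (fun a _ => norm_nonneg _)
      fun a _ => norm_truncate_le_bound hM _).trans ?_
    simp [two_mul]

omit [DecidableEq ι] in
theorem norm_integral_walkMonomial_le_pow {M : ℝ} (hM : 0 ≤ M) (γ γ' : Fin (m + 1) → ι) :
    ‖∫ x, walkMonomial (truncate M) γ x * conj (walkMonomial (truncate M) γ' x)
      ∂(Measure.pi fun _ : ι × ι => ξ)‖ ≤ M ^ (2 * (m + 1)) := by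
  refine (norm_integral_le_of_norm_le_const (C := M ^ (2 * (m + 1)))
    (Eventually.of_forall fun x => ?_)).trans (by simp)
  rw [norm_walkMonomial_mul_conj]
  refine (Finset.prod_le_prod (fun a _ => norm_nonneg _)
      fun a _ => norm_truncate_le_bound hM _).trans ?_
  simp [two_mul]

theorem integral_walkMonomial_eq_zero (hsymm : ξ.map (fun z => -z) = ξ) (M : ℝ)
    {γ γ' : Fin (m + 1) → ι}
    (hodd : ¬∀ e, Even (Finset.univ.filter fun a => pairEntry γ γ' a = e).card) :
    ∫ x, walkMonomial (truncate M) γ x * conj (walkMonomial (truncate M) γ' x)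
      ∂(Measure.pi fun _ : ι × ι => ξ) = 0 := by
  push Not at hodd
  obtain ⟨e, he⟩ := hodd
  refine integral_eq_zero_of_signFlip hsymm e fun x => ?_
  rw [walkMonomial_mul_conj_signFlip (truncate_neg M),
    Odd.neg_one_pow (Nat.not_even_iff_odd.1 he), neg_one_mul]

/-- Every entry occurs exactly twice, so only second moments appear, and truncation does not
increase them. The bound is thus free of `M`. -/
theorem norm_integral_walkMonomial_le_one (hvar : ∫ z, ‖z‖ ^ 2 ∂ξ = 1) (M : ℝ)
    {γ γ' : Fin (m + 1) → ι} (h : IsTwicePair γ γ') :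
    ‖∫ x, walkMonomial (truncate M) γ x * conj (walkMonomial (truncate M) γ' x)
      ∂(Measure.pi fun _ : ι × ι => ξ)‖ ≤ 1 := by
  refine (norm_integral_le_integral_norm _).trans ?_
  have htwo : ∀ a, (Finset.univ.filter fun a' => pairEntry γ γ' a' = pairEntry γ γ' a).card = 2 :=
    fun a => by
      rw [← (h a).1]
      congr 1
      refine Finset.filter_congr fun a' _ => ?_
      rw [pairEntry, pairEntry, Prod.mk.injEq]
      exact ⟨fun h' => h'.1, fun h' => ⟨h', (h a).2 a' h'⟩⟩
  have heq : ∀ x : ι × ι → ℂ,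
      ‖walkMonomial (truncate M) γ x * conj (walkMonomial (truncate M) γ' x)‖ =
        ∏ e ∈ Finset.univ.image (pairEntry γ γ'), ‖truncate M (x e)‖ ^ 2 := fun x => by
    rw [norm_walkMonomial_mul_conj, Finset.prod_comp (fun e => ‖truncate M (x e)‖)]
    refine Finset.prod_congr rfl fun e he => ?_
    obtain ⟨a, -, rfl⟩ := Finset.mem_image.1 he
    rw [htwo a]
  simp only [heq]
  rw [integral_prod_finset _ fun z => ‖truncate M z‖ ^ 2]
  exact pow_le_one₀ (integral_nonneg fun z => by positivity)
    (integral_norm_sq_truncate_le_one hvar M)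

theorem trace_pow_weightedMatrix {n : ℕ} (b : Matrix (Fin n) (Fin n) ℝ) (φ : ℂ → ℂ)
    (x : Fin n × Fin n → ℂ) (m : ℕ) :
    ((weightedMatrix b fun i j => φ (x (i, j))) ^ (m + 1)).trace =
      ∑ γ : Fin (m + 1) → Fin n, ((∏ t, b (γ t) (γ (t + 1)) : ℝ) : ℂ) * walkMonomial φ γ x := by
  rw [trace_pow_eq_sum_closedWalks]
  refine Finset.sum_congr rfl fun γ _ => ?_
  simp only [weightedMatrix, Matrix.of_apply, walkMonomial]
  rw [Finset.prod_mul_distrib]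
  push_cast
  rfl

theorem walkWeight_le_pow {n : ℕ} {b : Matrix (Fin n) (Fin n) ℝ} {L : ℝ}
    (hs : ∀ i j, varianceProfile b i j ≤ L) (γ γ' : Fin (m + 1) → Fin n) :
    walkWeight b γ * walkWeight b γ' ≤ L ^ (m + 1) := by
  have hb : ∀ i j, |b i j| ≤ √L := fun i j => Real.abs_le_sqrt (hs i j)
  have hL : 0 ≤ L := (sq_nonneg _).trans (hs (γ 0) (γ 0))
  have h1 : ∀ γ : Fin (m + 1) → Fin n, walkWeight b γ ≤ √L ^ (m + 1) := fun γ => by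
    refine (Finset.prod_le_prod (fun t _ => abs_nonneg _) fun t _ => hb _ _).trans ?_
    simp
  calc _ ≤ √L ^ (m + 1) * √L ^ (m + 1) :=
        mul_le_mul (h1 γ) (h1 γ') (walkWeight_nonneg _ _) (by positivity)
    _ = L ^ (m + 1) := by rw [← mul_pow, Real.mul_self_sqrt hL]

/-- The second moment of the trace of a power of the truncated matrix. -/
theorem integral_norm_sq_trace_le (hsymm : ξ.map (fun z => -z) = ξ) (hvar : ∫ z, ‖z‖ ^ 2 ∂ξ = 1)
    {n : ℕ} {b : Matrix (Fin n) (Fin n) ℝ} {M D θ L : ℝ} (hM : 0 ≤ M) (hD : 0 ≤ D) (hθ : 0 ≤ θ)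
    (hL : 0 ≤ L) (hs : ∀ i j, varianceProfile b i j ≤ L)
    (htr : ∀ j, 1 ≤ j → (varianceProfile b ^ j).trace ≤ D * θ ^ (2 * j)) (m : ℕ) :
    ∫ x, ‖((weightedMatrix b fun i j => truncate M (x (i, j))) ^ (m + 1)).trace‖ ^ 2
        ∂(Measure.pi fun _ : Fin n × Fin n => ξ) ≤
      ((m + 1 : ℕ) * D + D ^ 2) * θ ^ (2 * (m + 1)) +
        (m : ℝ) ^ (2 * (m + 1)) * (n : ℝ) ^ m * (L ^ (m + 1) * M ^ (2 * (m + 1))) := by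
  classical
  set μ := Measure.pi fun _ : Fin n × Fin n => ξ with hμ
  set F : (Fin (m + 1) → Fin n) → (Fin (m + 1) → Fin n) → (Fin n × Fin n → ℂ) → ℂ :=
    fun γ γ' x => walkMonomial (truncate M) γ x * conj (walkMonomial (truncate M) γ' x) with hF
  set β : (Fin (m + 1) → Fin n) → ℝ := fun γ => ∏ t, b (γ t) (γ (t + 1)) with hβ
  have hβabs : ∀ γ, |β γ| = walkWeight b γ := fun γ => Finset.abs_prod _ _
  have hFint : ∀ γ γ', Integrable (F γ γ') μ := fun γ γ' => integrable_walkMonomial_mul_conj hM γ γ'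
  have hpoint : ∀ x : Fin n × Fin n → ℂ,
      ((‖((weightedMatrix b fun i j => truncate M (x (i, j))) ^ (m + 1)).trace‖ ^ 2 : ℝ) : ℂ) =
        ∑ γ, ∑ γ', ((β γ * β γ' : ℝ) : ℂ) * F γ γ' x := fun x => by
    rw [trace_pow_weightedMatrix, Complex.ofReal_pow, ← Complex.mul_conj', map_sum,
      Finset.sum_mul_sum]
    refine Finset.sum_congr rfl fun γ _ => Finset.sum_congr rfl fun γ' _ => ?_
    rw [map_mul, Complex.conj_ofReal, Complex.ofReal_mul]
    ring
  have hexp : ((∫ x, ‖((weightedMatrix b fun i j => truncate M (x (i, j))) ^ (m + 1)).trace‖ ^ 2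
      ∂μ : ℝ) : ℂ) = ∑ γ, ∑ γ', ((β γ * β γ' : ℝ) : ℂ) * ∫ x, F γ γ' x ∂μ := by
    rw [← integral_complex_ofReal]
    simp only [hpoint]
    rw [integral_finsetSum _ fun γ _ => integrable_finsetSum _ fun γ' _ =>
      (hFint γ γ').const_mul _]
    refine Finset.sum_congr rfl fun γ _ => ?_
    rw [integral_finsetSum _ fun γ' _ => (hFint γ γ').const_mul _]
    exact Finset.sum_congr rfl fun γ' _ => integral_const_mul _ _
  set few : Finset (Fin (m + 1) ⊕ Fin (m + 1) → Fin n) :=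
    Finset.univ.filter fun w => (Finset.univ.image w).card ≤ m with hfew
  set G : Finset ((Fin (m + 1) → Fin n) × (Fin (m + 1) → Fin n)) :=
    Finset.univ.filter fun p => IsTwicePair p.1 p.2 with hG
  set c : ℝ := L ^ (m + 1) * M ^ (2 * (m + 1)) with hc
  have hc0 : 0 ≤ c := by positivity
  -- Three cases: an entry of odd multiplicity gives zero; at most `m` distinct vertices give the
  -- crude bound `c`; otherwise there are at least `m + 1` vertices, and counting forces a twice
  -- pair.
  have hterm : ∀ p : (Fin (m + 1) → Fin n) × (Fin (m + 1) → Fin n),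
      ‖((β p.1 * β p.2 : ℝ) : ℂ) * ∫ x, F p.1 p.2 x ∂μ‖ ≤
        (if IsTwicePair p.1 p.2 then walkWeight b p.1 * walkWeight b p.2 else 0) +
          if Sum.elim p.1 p.2 ∈ few then c else 0 := fun p => by
    have hw0 : 0 ≤ walkWeight b p.1 * walkWeight b p.2 :=
      mul_nonneg (walkWeight_nonneg _ _) (walkWeight_nonneg _ _)
    have h1 : 0 ≤ if IsTwicePair p.1 p.2 then walkWeight b p.1 * walkWeight b p.2 else 0 := by
      split_ifs
      · exact hw0
      · exact le_rfl
    have h2 : 0 ≤ if Sum.elim p.1 p.2 ∈ few then c else 0 := by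
      split_ifs
      · exact hc0
      · exact le_rfl
    rw [norm_mul, Complex.norm_real, Real.norm_eq_abs, abs_mul, hβabs, hβabs]
    by_cases heven : ∀ e, Even (Finset.univ.filter fun a => pairEntry p.1 p.2 a = e).card
    · by_cases hcard : (Finset.univ.image (Sum.elim p.1 p.2)).card ≤ m
      · rw [if_pos (show Sum.elim p.1 p.2 ∈ few by simpa [hfew] using hcard)]
        refine le_add_of_nonneg_of_le h1 ?_
        exact mul_le_mul (walkWeight_le_pow hs _ _) (norm_integral_walkMonomial_le_pow hM _ _)
          (norm_nonneg _) (by positivity)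
      · have htwice : IsTwicePair p.1 p.2 := fun a =>
          visited_twice_of_even (k := m + 1) (by simp [two_mul]) heven (by omega) a
        rw [if_pos htwice]
        refine le_add_of_le_of_nonneg ?_ h2
        exact mul_le_of_le_one_right hw0 (norm_integral_walkMonomial_le_one hvar M htwice)
    · have h3 : ∫ x, F p.1 p.2 x ∂μ = 0 := integral_walkMonomial_eq_zero hsymm M heven
      rw [h3, norm_zero, mul_zero]
      exact add_nonneg h1 h2
  have hfewcard : (∑ p : (Fin (m + 1) → Fin n) × (Fin (m + 1) → Fin n),
      if Sum.elim p.1 p.2 ∈ few then c else 0) ≤ (m : ℝ) ^ (2 * (m + 1)) * (n : ℝ) ^ m * c := by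
    have h1 : (∑ p : (Fin (m + 1) → Fin n) × (Fin (m + 1) → Fin n),
        if Sum.elim p.1 p.2 ∈ few then c else 0) =
        ∑ w : Fin (m + 1) ⊕ Fin (m + 1) → Fin n, if w ∈ few then c else 0 :=
      (Equiv.sumArrowEquivProdArrow _ _ _).symm.sum_comp (fun w => if w ∈ few then c else 0)
    rw [h1, Finset.sum_ite_mem, Finset.univ_inter, Finset.sum_const, nsmul_eq_mul]
    refine mul_le_mul_of_nonneg_right ?_ hc0
    have h2 := card_filter_card_image_le (V := Fin (m + 1) ⊕ Fin (m + 1)) (ι := Fin n) m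
    have h3 : Fintype.card (Fin (m + 1) ⊕ Fin (m + 1)) = 2 * (m + 1) := by simp [two_mul]
    rw [h3, Fintype.card_fin] at h2
    exact_mod_cast h2
  have hnn : 0 ≤ ∫ x, ‖((weightedMatrix b fun i j => truncate M (x (i, j))) ^ (m + 1)).trace‖ ^ 2
      ∂μ := integral_nonneg fun x => by positivity
  calc ∫ x, ‖((weightedMatrix b fun i j => truncate M (x (i, j))) ^ (m + 1)).trace‖ ^ 2 ∂μ
      = ‖((∫ x, ‖((weightedMatrix b fun i j => truncate M (x (i, j))) ^ (m + 1)).trace‖ ^ 2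
          ∂μ : ℝ) : ℂ)‖ := by rw [Complex.norm_real, Real.norm_of_nonneg hnn]
    _ = ‖∑ p : (Fin (m + 1) → Fin n) × (Fin (m + 1) → Fin n),
          ((β p.1 * β p.2 : ℝ) : ℂ) * ∫ x, F p.1 p.2 x ∂μ‖ := by
        rw [hexp, Fintype.sum_prod_type]
    _ ≤ ∑ p : (Fin (m + 1) → Fin n) × (Fin (m + 1) → Fin n),
          ((if IsTwicePair p.1 p.2 then walkWeight b p.1 * walkWeight b p.2 else 0) +
          if Sum.elim p.1 p.2 ∈ few then c else 0) := norm_sum_le_of_le _ fun p _ => hterm p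
    _ ≤ _ := by
        rw [Finset.sum_add_distrib, ← Finset.sum_filter]
        exact add_le_add (sum_walkWeight_twicePair_le hD hθ htr G
          fun p hp => (Finset.mem_filter.1 hp).2) hfewcard

end TraceMoments

/-! ### A criterion for `det (1 - z A)` to have no zero in the unit disc. -/

section Nonvanishing

variable {ι : Type*} [Fintype ι] [DecidableEq ι]

/-- The product of a series with its inverse, sorted by total degree; `K < R` keeps every
antidiagonal up to `K` inside the box. -/
theorem sum_coeff_mul_invRevCoeff_mul_pow (A : Matrix ι ι ℂ) (z : ℂ) {K R : ℕ} (hR : K < R) :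
    ∑ p ∈ (Finset.range R ×ˢ Finset.range (K + 1)).filter (fun p => p.1 + p.2 ≤ K),
      A.charpolyRev.coeff p.1 * invRevCoeff A p.2 * z ^ (p.1 + p.2) = 1 := by
  rw [← Finset.sum_fiberwise_of_maps_to
    (s := (Finset.range R ×ˢ Finset.range (K + 1)).filter (fun p => p.1 + p.2 ≤ K))
    (t := Finset.range (K + 1)) (g := fun p : ℕ × ℕ => p.1 + p.2)
    (fun p hp => Finset.mem_range.2 (Nat.lt_succ_of_le (Finset.mem_filter.1 hp).2))]
  have h : ∀ m ∈ Finset.range (K + 1),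
      ∑ p ∈ ((Finset.range R ×ˢ Finset.range (K + 1)).filter (fun p => p.1 + p.2 ≤ K)).filter
        (fun p => p.1 + p.2 = m),
        A.charpolyRev.coeff p.1 * invRevCoeff A p.2 * z ^ (p.1 + p.2) =
      if m = 0 then 1 else 0 := fun m hm => by
    have hm' := Finset.mem_range.1 hm
    have hset : ((Finset.range R ×ˢ Finset.range (K + 1)).filter (fun p => p.1 + p.2 ≤ K)).filter
        (fun p => p.1 + p.2 = m) = Finset.HasAntidiagonal.antidiagonal m := by
      ext p
      simp only [Finset.mem_filter, Finset.mem_product, Finset.mem_range,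
        Finset.HasAntidiagonal.mem_antidiagonal]
      omega
    rw [hset]
    have h1 : ∑ p ∈ Finset.HasAntidiagonal.antidiagonal m,
        A.charpolyRev.coeff p.1 * invRevCoeff A p.2 * z ^ (p.1 + p.2) =
        (∑ p ∈ Finset.HasAntidiagonal.antidiagonal m,
          A.charpolyRev.coeff p.1 * invRevCoeff A p.2) * z ^ m := by
      rw [Finset.sum_mul]
      refine Finset.sum_congr rfl fun p hp => ?_
      rw [Finset.HasAntidiagonal.mem_antidiagonal.1 hp]
    rw [h1, sum_coeff_mul_invRevCoeff]
    split_ifs with h0 <;> simp [h0]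
  rw [Finset.sum_congr rfl h, Finset.sum_ite_eq' ]
  simp

/-- If the polynomials `f` and `h` are inverse to each other up to degree `2 ℓ`, then `d` has no
zero in the closed unit disc as soon as its low coefficients are close to those of `f` and its high
coefficients are small. -/
theorem sum_mul_pow_ne_zero {d f h : ℕ → ℂ} {V : ℕ → ℝ} {ℓ R : ℕ} {W U τ u δ : ℝ} {z : ℂ}
    (hone : ∑ p ∈ (Finset.range R ×ˢ Finset.range (2 * ℓ + 1)).filter
      (fun p => p.1 + p.2 ≤ 2 * ℓ), f p.1 * h p.2 * z ^ (p.1 + p.2) = 1)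
    (hV0 : ∀ j, 0 ≤ V j) (hh : ∀ j ≤ 2 * ℓ, ‖h j‖ ≤ V j)
    (hW : ∑ j ∈ Finset.range (2 * ℓ + 1), V j ≤ W)
    (hτ : ∑ j ∈ (Finset.range (2 * ℓ + 1)).filter (ℓ < ·), V j ≤ τ)
    (hU : ∑ i ∈ Finset.range R, ‖d i‖ ≤ U)
    (hu : ∑ i ∈ (Finset.range R).filter (ℓ < ·), ‖d i‖ ≤ u)
    (hδ : ∑ i ∈ Finset.range (2 * ℓ + 1), ‖d i - f i‖ ≤ δ)
    (hlt : δ * W + (u * W + U * τ) < 1) (hz : ‖z‖ ≤ 1) :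
    ∑ i ∈ Finset.range R, d i * z ^ i ≠ 0 := by
  set K := 2 * ℓ with hK
  have hzpow : ∀ i, ‖z ^ i‖ ≤ 1 := fun i => by
    rw [norm_pow]; exact pow_le_one₀ (norm_nonneg _) hz
  set Box := Finset.range R ×ˢ Finset.range (K + 1) with hBox
  -- Below total degree `K`, `d` is compared with `f`, whose product with `h` gives exactly 1; the
  -- terms above `K` are pure error.
  have hprod : (∑ i ∈ Finset.range R, d i * z ^ i) * ∑ j ∈ Finset.range (K + 1), h j * z ^ j =
      1 + (∑ p ∈ Box.filter (fun p => p.1 + p.2 ≤ K), (d p.1 - f p.1) * h p.2 * z ^ (p.1 + p.2) +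
        ∑ p ∈ Box.filter (fun p => ¬p.1 + p.2 ≤ K), d p.1 * h p.2 * z ^ (p.1 + p.2)) := by
    have h1 : (∑ i ∈ Finset.range R, d i * z ^ i) * ∑ j ∈ Finset.range (K + 1), h j * z ^ j =
        ∑ p ∈ Box, d p.1 * h p.2 * z ^ (p.1 + p.2) := by
      rw [Finset.sum_mul_sum, ← Finset.sum_product']
      exact Finset.sum_congr rfl fun p _ => by rw [pow_add]; ring
    have h2 : ∑ p ∈ Box.filter (fun p => p.1 + p.2 ≤ K), d p.1 * h p.2 * z ^ (p.1 + p.2) =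
        1 + ∑ p ∈ Box.filter (fun p => p.1 + p.2 ≤ K),
          (d p.1 - f p.1) * h p.2 * z ^ (p.1 + p.2) := by
      rw [← hone, ← Finset.sum_add_distrib]
      exact Finset.sum_congr rfl fun p _ => by ring
    rw [h1, ← add_assoc, ← h2]
    exact (Finset.sum_filter_add_sum_filter_not Box (fun p => p.1 + p.2 ≤ K) _).symm
  have hmem : ∀ p ∈ Box, p.1 < R ∧ p.2 ≤ K := fun p hp => by
    rw [hBox, Finset.mem_product, Finset.mem_range, Finset.mem_range] at hp
    omega
  have hb1 : ‖∑ p ∈ Box.filter (fun p => p.1 + p.2 ≤ K),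
      (d p.1 - f p.1) * h p.2 * z ^ (p.1 + p.2)‖ ≤ δ * W := by
    have hδ0 : 0 ≤ δ := (Finset.sum_nonneg fun _ _ => norm_nonneg _).trans hδ
    calc _ ≤ ∑ p ∈ Box.filter (fun p => p.1 + p.2 ≤ K), ‖d p.1 - f p.1‖ * V p.2 := by
          refine norm_sum_le_of_le _ fun p hp => ?_
          have := hmem p (Finset.mem_filter.1 hp).1
          rw [norm_mul, norm_mul]
          refine (mul_le_of_le_one_right (by positivity) (hzpow _)).trans ?_
          exact mul_le_mul_of_nonneg_left (hh _ this.2) (norm_nonneg _)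
      _ ≤ ∑ p ∈ Finset.range (K + 1) ×ˢ Finset.range (K + 1), ‖d p.1 - f p.1‖ * V p.2 := by
          refine Finset.sum_le_sum_of_subset_of_nonneg (fun p hp => ?_) fun p _ _ =>
            mul_nonneg (norm_nonneg _) (hV0 _)
          have := (Finset.mem_filter.1 hp).2
          rw [Finset.mem_product, Finset.mem_range, Finset.mem_range]
          omega
      _ = (∑ i ∈ Finset.range (K + 1), ‖d i - f i‖) * ∑ j ∈ Finset.range (K + 1), V j := by
          rw [Finset.sum_mul_sum, ← Finset.sum_product']
      _ ≤ δ * W := mul_le_mul hδ hW (Finset.sum_nonneg fun _ _ => hV0 _) hδ0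
  have hb2 : ‖∑ p ∈ Box.filter (fun p => ¬p.1 + p.2 ≤ K), d p.1 * h p.2 * z ^ (p.1 + p.2)‖ ≤
      u * W + U * τ := by
    have hu0 : 0 ≤ u := (Finset.sum_nonneg fun _ _ => norm_nonneg _).trans hu
    have hU0 : 0 ≤ U := (Finset.sum_nonneg fun _ _ => norm_nonneg _).trans hU
    -- If the two degrees add up to more than `2 * ℓ`, one of them exceeds `ℓ`.
    set P₁ := (Finset.range R).filter (ℓ < ·) ×ˢ Finset.range (K + 1)
    set P₂ := Finset.range R ×ˢ (Finset.range (K + 1)).filter (ℓ < ·)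
    have hnn : ∀ p : ℕ × ℕ, 0 ≤ ‖d p.1‖ * V p.2 := fun p => mul_nonneg (norm_nonneg _) (hV0 _)
    calc _ ≤ ∑ p ∈ Box.filter (fun p => ¬p.1 + p.2 ≤ K), ‖d p.1‖ * V p.2 := by
          refine norm_sum_le_of_le _ fun p hp => ?_
          have := hmem p (Finset.mem_filter.1 hp).1
          rw [norm_mul, norm_mul]
          refine (mul_le_of_le_one_right (by positivity) (hzpow _)).trans ?_
          exact mul_le_mul_of_nonneg_left (hh _ this.2) (norm_nonneg _)
      _ ≤ ∑ p ∈ P₁ ∪ P₂, ‖d p.1‖ * V p.2 := by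
          refine Finset.sum_le_sum_of_subset_of_nonneg (fun p hp => ?_) fun p _ _ => hnn p
          obtain ⟨hp1, hp2⟩ := Finset.mem_filter.1 hp
          have := hmem p hp1
          simp only [P₁, P₂, Finset.mem_union, Finset.mem_product, Finset.mem_filter,
            Finset.mem_range]
          omega
      _ ≤ ∑ p ∈ P₁, ‖d p.1‖ * V p.2 + ∑ p ∈ P₂, ‖d p.1‖ * V p.2 := by
          rw [← Finset.sum_union_inter]
          exact le_add_of_nonneg_right (Finset.sum_nonneg fun p _ => hnn p)
      _ = (∑ i ∈ (Finset.range R).filter (ℓ < ·), ‖d i‖) * (∑ j ∈ Finset.range (K + 1), V j) +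
          (∑ i ∈ Finset.range R, ‖d i‖) * ∑ j ∈ (Finset.range (K + 1)).filter (ℓ < ·), V j := by
          rw [Finset.sum_mul_sum, Finset.sum_mul_sum, ← Finset.sum_product', ← Finset.sum_product']
      _ ≤ u * W + U * τ := add_le_add
          (mul_le_mul hu hW (Finset.sum_nonneg fun _ _ => hV0 _) hu0)
          (mul_le_mul hU hτ (Finset.sum_nonneg fun _ _ => hV0 _) hU0)
  intro h0
  rw [h0, zero_mul] at hprod
  have h1 := (norm_add_le _ _).trans (add_le_add hb1 hb2)
  rw [show ∀ w : ℂ, (0 : ℂ) = 1 + w ↔ w = -1 from fun w =>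
    ⟨fun h => by linear_combination -h, fun h => by rw [h]; ring⟩] at hprod
  rw [hprod, norm_neg, norm_one] at h1
  linarith

/-- `det (1 - z A)` has no zero in the closed unit disc if its low coefficients are close to those
of `A'`, its high coefficients are small, and the inverse of `det (1 - z A')` is under control. -/
theorem det_one_sub_smul_ne_zero {A A' : Matrix ι ι ℂ} {V : ℕ → ℝ} {ℓ R : ℕ}
    {W U τ u δ : ℝ} (hR : Fintype.card ι < R) (hRℓ : 2 * ℓ < R) (hV0 : ∀ j, 0 ≤ V j)
    (hh : ∀ j ≤ 2 * ℓ, ‖invRevCoeff A' j‖ ≤ V j)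
    (hW : ∑ j ∈ Finset.range (2 * ℓ + 1), V j ≤ W)
    (hτ : ∑ j ∈ (Finset.range (2 * ℓ + 1)).filter (ℓ < ·), V j ≤ τ)
    (hU : ∑ i ∈ Finset.range R, ‖A.charpolyRev.coeff i‖ ≤ U)
    (hu : ∑ i ∈ (Finset.range R).filter (ℓ < ·), ‖A.charpolyRev.coeff i‖ ≤ u)
    (hδ : ∑ i ∈ Finset.range (2 * ℓ + 1), ‖A.charpolyRev.coeff i - A'.charpolyRev.coeff i‖ ≤ δ)
    (hlt : δ * W + (u * W + U * τ) < 1) {z : ℂ} (hz : ‖z‖ ≤ 1) :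
    (1 - z • A).det ≠ 0 := by
  have hdet : (1 - z • A).det = ∑ i ∈ Finset.range R, A.charpolyRev.coeff i * z ^ i := by
    rw [det_one_sub_smul]
    refine Finset.sum_subset (Finset.range_mono (by omega)) fun i _ hi => ?_
    rw [coeff_charpolyRev, partialPerms_eq_empty (by simpa using hi), Finset.sum_empty, zero_mul]
  rw [hdet]
  exact sum_mul_pow_ne_zero (sum_coeff_mul_invRevCoeff_mul_pow A' z hRℓ) hV0 hh hW hτ hU hu hδ hlt
    hz

theorem norm_invRevCoeff_le {A : Matrix ι ι ℂ} {B K : ℕ} {q : ℝ} (hq : 0 ≤ q)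
    (htr : ∀ j, 1 ≤ j → j ≤ K → ‖(A ^ j).trace‖ ≤ ((B + 1 : ℕ) : ℝ) * q ^ j) (k : ℕ) (hk : k ≤ K) :
    ‖invRevCoeff A k‖ ≤ negBinomCoeff B q k := by
  refine le_negBinomCoeff_of_recursion (u := fun k => ‖invRevCoeff A k‖)
    (t := fun j => ‖(A ^ j).trace‖) hq (fun _ => norm_nonneg _)
    (by simp [invRevCoeff_zero]) htr (fun k _ => ?_) k hk
  have h1 : ((k : ℝ) + 1) * ‖invRevCoeff A (k + 1)‖ =
      ‖((k : ℂ) + 1) * invRevCoeff A (k + 1)‖ := by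
    rw [norm_mul]
    congr 1
    have : ((k : ℂ) + 1) = ((k + 1 : ℕ) : ℂ) := by push_cast; rfl
    rw [this, Complex.norm_natCast]
    push_cast
    rfl
  rw [h1, succ_mul_invRevCoeff]
  exact norm_sum_le_of_le _ fun i _ => (norm_mul _ _).le

end Nonvanishing

/-! ### Series tails and Markov-type bounds. -/

section Estimates

/-- Turns a bound on second moments with ratio `θ ^ 2` into one on L² norms with ratio `θ`; it
suffices that binomial coefficients are at least 1. -/
theorem negBinomCoeff_sq_le (B : ℕ) {θ : ℝ} (k : ℕ) :
    negBinomCoeff B (θ ^ 2) k ≤ negBinomCoeff B θ k ^ 2 := by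
  unfold negBinomCoeff
  have h1 : (1 : ℝ) ≤ ((k + B).choose B : ℝ) := by
    exact_mod_cast Nat.choose_pos (Nat.le_add_left B k)
  have h2 : (θ ^ 2) ^ k = (θ ^ k) ^ 2 := by rw [← pow_mul, ← pow_mul, mul_comm]
  rw [h2, mul_pow]
  refine mul_le_mul_of_nonneg_right ?_ (sq_nonneg _)
  nlinarith

theorem negBinomCoeff_pos (B : ℕ) {θ : ℝ} (hθ : 0 < θ) (k : ℕ) : 0 < negBinomCoeff B θ k := by
  have : 0 < (k + B).choose B := Nat.choose_pos (Nat.le_add_left B k)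
  unfold negBinomCoeff
  positivity

/-- Tails of a convergent series of nonnegative terms. -/
theorem eventually_sum_filter_lt_le {u : ℕ → ℝ} (hu : Summable u) (hu0 : ∀ i, 0 ≤ u i) {ε : ℝ}
    (hε : 0 < ε) :
    ∀ᶠ ℓ in atTop, ∀ R, ∑ i ∈ (Finset.range R).filter (ℓ < ·), u i ≤ ε := by
  have h1 : Tendsto (fun ℓ => ∑ i ∈ Finset.range (ℓ + 1), u i) atTop (𝓝 (∑' i, u i)) :=
    hu.hasSum.tendsto_sum_nat.comp (tendsto_add_atTop_nat 1)
  filter_upwards [h1.eventually_const_lt (show ∑' i, u i - ε < ∑' i, u i by linarith)]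
    with ℓ hℓ R
  have hdisj : Disjoint ((Finset.range R).filter (ℓ < ·)) (Finset.range (ℓ + 1)) := by
    rw [Finset.disjoint_left]
    intro i hi hi'
    have := (Finset.mem_filter.1 hi).2
    have := Finset.mem_range.1 hi'
    omega
  have h2 := hu.sum_le_tsum ((Finset.range R).filter (ℓ < ·) ∪ Finset.range (ℓ + 1))
    fun i _ => hu0 i
  rw [Finset.sum_union hdisj] at h2
  linarith

variable {Ω : Type*} [MeasurableSpace Ω] {μ : Measure Ω} [IsProbabilityMeasure μ]

/-- Integrate `2 * s * ‖y‖ ≤ ‖y‖ ^ 2 + s ^ 2`. -/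
theorem integral_norm_le_of_sq {y : Ω → ℂ} (hy : MemLp y 2 μ) {s : ℝ} (hs : 0 < s)
    (h : ∫ x, ‖y x‖ ^ 2 ∂μ ≤ s ^ 2) : ∫ x, ‖y x‖ ∂μ ≤ s := by
  have h2 : Integrable (fun x => ‖y x‖ ^ 2) μ := hy.integrable_norm_pow two_ne_zero
  have h1 : Integrable (fun x => ‖y x‖) μ := (hy.integrable one_le_two).norm
  have h3 : ∫ x, 2 * s * ‖y x‖ ∂μ ≤ ∫ x, (‖y x‖ ^ 2 + s ^ 2) ∂μ :=
    integral_mono (h1.const_mul _) (h2.add (integrable_const _)) fun x => by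
      have := sq_nonneg (‖y x‖ - s)
      dsimp only
      nlinarith
  rw [integral_const_mul, integral_add h2 (integrable_const _), integral_const] at h3
  simp only [probReal_univ, one_smul] at h3
  nlinarith

theorem measureReal_ge_le_of_sum_norm {α : Type*} (s : Finset α) {y : α → Ω → ℂ}
    (hy : ∀ i ∈ s, MemLp (y i) 2 μ) {c : α → ℝ} (hc : ∀ i ∈ s, 0 < c i)
    (h : ∀ i ∈ s, ∫ x, ‖y i x‖ ^ 2 ∂μ ≤ c i ^ 2) {t η : ℝ} (ht : 0 < t)
    (hη : ∑ i ∈ s, c i ≤ t * η) : μ.real {x | t ≤ ∑ i ∈ s, ‖y i x‖} ≤ η := by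
  have hint : ∀ i ∈ s, Integrable (fun x => ‖y i x‖) μ := fun i hi =>
    ((hy i hi).integrable one_le_two).norm
  have h1 := mul_meas_ge_le_integral_of_nonneg (μ := μ) (f := fun x => ∑ i ∈ s, ‖y i x‖)
    (Eventually.of_forall fun x => Finset.sum_nonneg fun _ _ => norm_nonneg _)
    (integrable_finsetSum _ hint) t
  rw [integral_finsetSum _ hint] at h1
  have h2 := Finset.sum_le_sum fun i hi => integral_norm_le_of_sq (hy i hi) (hc i hi) (h i hi)
  exact le_of_mul_le_mul_left (h1.trans (h2.trans hη)) ht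

omit [IsProbabilityMeasure μ] in
theorem measureReal_exists_ge_le {α : Type*} (s : Finset α) {y : α → Ω → ℂ}
    (hy : ∀ i ∈ s, MemLp (y i) 2 μ) {c t : α → ℝ} (ht : ∀ i ∈ s, 0 < t i)
    (h : ∀ i ∈ s, ∫ x, ‖y i x‖ ^ 2 ∂μ ≤ c i) :
    μ.real {x | ∃ i ∈ s, t i ≤ ‖y i x‖} ≤ ∑ i ∈ s, c i / t i ^ 2 := by
  have hset : {x | ∃ i ∈ s, t i ≤ ‖y i x‖} = ⋃ i ∈ s, {x | t i ≤ ‖y i x‖} := by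
    ext x; simp
  rw [hset]
  refine (measureReal_biUnion_finset_le _ _).trans (Finset.sum_le_sum fun i hi => ?_)
  have h1 := mul_meas_ge_le_integral_of_nonneg (μ := μ) (f := fun x => ‖y i x‖ ^ 2)
    (Eventually.of_forall fun x => by positivity) ((hy i hi).integrable_norm_pow two_ne_zero)
    (t i ^ 2)
  have h2 : {x | t i ≤ ‖y i x‖} = {x | t i ^ 2 ≤ ‖y i x‖ ^ 2} := by
    ext x
    exact (pow_le_pow_iff_left₀ (ht i hi).le (norm_nonneg _) two_ne_zero).symm
  have := ht i hi
  rw [le_div_iff₀ (by positivity), mul_comm, h2]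
  exact h1.trans (h i hi)

end Estimates

/-! ### Square integrability of coefficients and traces. -/

section CoreMemLp

variable {ξ : Measure ℂ} [IsProbabilityMeasure ξ] {n : ℕ} (b : Matrix (Fin n) (Fin n) ℝ)

theorem memLp_coeff_charpolyRev {φ : ℂ → ℂ} (hφ : Measurable φ)
    (hint : Integrable (fun z => ‖φ z‖ ^ 2) ξ) (k : ℕ) :
    MemLp (fun x => (weightedMatrix b fun i j => φ (x (i, j))).charpolyRev.coeff k) 2
      (Measure.pi fun _ : Fin n × Fin n => ξ) := by
  simp only [coeff_charpolyRev_weightedMatrix]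
  exact memLp_finsetSum _ fun a _ => (memLp_permMonomial hφ hint a).const_mul _

theorem memLp_trace_pow {M : ℝ} (hM : 0 ≤ M) (m : ℕ) :
    MemLp (fun x => ((weightedMatrix b fun i j => truncate M (x (i, j))) ^ (m + 1)).trace) 2
      (Measure.pi fun _ : Fin n × Fin n => ξ) := by
  simp only [trace_pow_weightedMatrix]
  refine memLp_finsetSum _ fun γ _ => MemLp.const_mul (MemLp.of_bound
    (measurable_walkMonomial (measurable_truncate M) γ).aestronglyMeasurable (M ^ (m + 1))
    (Eventually.of_forall fun x => ?_)) _
  rw [walkMonomial, norm_prod]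
  refine (Finset.prod_le_prod (fun a _ => norm_nonneg _)
    fun a _ => norm_truncate_le_bound hM _).trans ?_
  simp

end CoreMemLp

/-! ### Zero-free disc with high probability. -/

section Core

variable {ξ : Measure ℂ} [IsProbabilityMeasure ξ]

/-- The summable part of the failure probability of the trace bounds. -/
theorem exists_trace_threshold {D θ θ₁ η : ℝ} (hD : 0 ≤ D) (hθ : 0 < θ) (hθ₁ : θ < θ₁)
    (hη : 0 < η) : ∃ B : ℕ, ∀ K : ℕ, ∑ m ∈ Finset.range K,
      ((m + 1 : ℕ) * D + D ^ 2) * θ ^ (2 * (m + 1)) / (((B + 1 : ℕ) : ℝ) * θ₁ ^ (m + 1)) ^ 2 ≤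
        η := by
  have hθ₁0 : 0 < θ₁ := hθ.trans hθ₁
  set r := (θ / θ₁) ^ 2 with hr
  have hr0 : 0 ≤ r := sq_nonneg _
  have hr1 : r < 1 := by
    have : θ / θ₁ < 1 := (div_lt_one hθ₁0).2 hθ₁
    exact pow_lt_one₀ (by positivity) this two_ne_zero
  have hrn : ‖r‖ < 1 := by rwa [Real.norm_of_nonneg hr0]
  set a : ℕ → ℝ := fun j => (j * D + D ^ 2) * r ^ j with ha
  have ha0 : ∀ j, 0 ≤ a j := fun j => by rw [ha]; positivity
  have hsum : Summable a := by
    have h1 : Summable fun j : ℕ => D * ((j : ℝ) ^ 1 * r ^ j) :=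
      (summable_pow_mul_geometric_of_norm_lt_one 1 hrn).mul_left D
    have h2 : Summable fun j : ℕ => D ^ 2 * r ^ j :=
      (summable_geometric_of_norm_lt_one hrn).mul_left _
    refine (h1.add h2).congr fun j => ?_
    rw [ha]; ring
  -- The series converges and the squared threshold carries `(B + 1) ^ 2`, so one `B` serves all
  -- `K`.
  obtain ⟨B, hB⟩ := exists_nat_ge ((∑' j, a j) / η)
  refine ⟨B, fun K => ?_⟩
  have hterm : ∀ m ∈ Finset.range K,
      ((m + 1 : ℕ) * D + D ^ 2) * θ ^ (2 * (m + 1)) / (((B + 1 : ℕ) : ℝ) * θ₁ ^ (m + 1)) ^ 2 =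
        a (m + 1) / ((B + 1 : ℕ) : ℝ) ^ 2 := fun m _ => by
    have : r ^ (m + 1) = θ ^ (2 * (m + 1)) / (θ₁ ^ (m + 1)) ^ 2 := by
      rw [hr, ← pow_mul, div_pow, ← pow_mul, mul_comm (m + 1) 2]
    rw [ha]
    dsimp only
    rw [this, mul_pow]
    field_simp
  rw [Finset.sum_congr rfl hterm, ← Finset.sum_div]
  have hle : ∑ m ∈ Finset.range K, a (m + 1) ≤ ∑' j, a j := by
    have := hsum.sum_le_tsum (Finset.range (K + 1)) fun j _ => ha0 j
    rw [Finset.sum_range_succ'] at this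
    have := ha0 0
    linarith
  rw [div_le_iff₀ (by positivity)]
  rw [div_le_iff₀ hη] at hB
  have hB1 : (B : ℝ) ≤ ((B + 1 : ℕ) : ℝ) ^ 2 := by
    push_cast
    nlinarith [(Nat.cast_nonneg B : (0 : ℝ) ≤ B)]
  calc _ ≤ ∑' j, a j := hle
    _ ≤ B * η := hB
    _ ≤ ((B + 1 : ℕ) : ℝ) ^ 2 * η := mul_le_mul_of_nonneg_right hB1 hη.le
    _ = _ := mul_comm _ _

/-- The negligible part of the failure probability of the trace bounds. -/
theorem exists_forall_negligible_le (K : ℕ) (L M : ℝ) (c : ℕ → ℝ) {η : ℝ} (hη : 0 < η) :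
    ∃ N : ℕ, 0 < N ∧ ∀ n ≥ N, ∑ m ∈ Finset.range K,
      (m : ℝ) ^ (2 * (m + 1)) * (n : ℝ) ^ m * ((L / n) ^ (m + 1) * M ^ (2 * (m + 1))) / c m ^ 2 ≤
        η := by
  set κ : ℝ := ∑ m ∈ Finset.range K,
    (m : ℝ) ^ (2 * (m + 1)) * (L ^ (m + 1) * M ^ (2 * (m + 1))) / c m ^ 2 with hκ
  obtain ⟨N, hN⟩ := exists_nat_ge (κ / η)
  refine ⟨N + 1, Nat.succ_pos N, fun n hn => ?_⟩
  have hn0 : (0 : ℝ) < n := by exact_mod_cast (Nat.succ_pos N).trans_le hn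
  have h : ∀ m ∈ Finset.range K,
      (m : ℝ) ^ (2 * (m + 1)) * (n : ℝ) ^ m * ((L / n) ^ (m + 1) * M ^ (2 * (m + 1))) / c m ^ 2 =
      (m : ℝ) ^ (2 * (m + 1)) * (L ^ (m + 1) * M ^ (2 * (m + 1))) / c m ^ 2 / n := fun m _ => by
    -- Walk pairs with few vertices lose one power of `n`, which leaves a constant over `n`.
    have : (n : ℝ) ^ m * (L / n) ^ (m + 1) = L ^ (m + 1) / n := by
      rw [div_pow, pow_succ (n : ℝ) m]
      field_simp
    calc _ = (m : ℝ) ^ (2 * (m + 1)) * ((n : ℝ) ^ m * (L / n) ^ (m + 1)) *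
          M ^ (2 * (m + 1)) / c m ^ 2 := by ring
      _ = _ := by rw [this]; ring
  rw [Finset.sum_congr rfl h, ← Finset.sum_div, ← hκ, div_le_iff₀ hn0]
  rw [div_le_iff₀ hη] at hN
  have : (N : ℝ) ≤ n := by exact_mod_cast (Nat.le_succ N).trans hn
  nlinarith

/-- With high probability `det (1 - z A)` has no zero in the closed unit disc. -/
theorem exists_forall_measureReal_zero_le (hsymm : ξ.map (fun z => -z) = ξ)
    (hvar : ∫ z, ‖z‖ ^ 2 ∂ξ = 1) (B : ℕ) {θ L η : ℝ} (hθ : 0 < θ) (hθ1 : θ < 1) (hL : 0 ≤ L)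
    (hη : 0 < η) :
    ∃ N : ℕ, ∀ n ≥ N, ∀ b : Matrix (Fin n) (Fin n) ℝ, (∀ i j, varianceProfile b i j ≤ L / n) →
      (∀ j, 1 ≤ j → (varianceProfile b ^ j).trace ≤ ((B + 1 : ℕ) : ℝ) * θ ^ (2 * j)) →
      (Measure.pi fun _ : Fin n × Fin n => ξ).real
        {x | ∃ z : ℂ, ‖z‖ ≤ 1 ∧ (1 - z • weightedMatrix b fun i j => x (i, j)).det = 0} ≤ η := by
  set u := negBinomCoeff B θ with hu
  have hupos : ∀ k, 0 < u k := negBinomCoeff_pos B hθ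
  have husum : Summable u := summable_negBinomCoeff B hθ.le hθ1
  set U₀ := ∑' k, u k with hU₀
  have hU₀pos : 0 < U₀ := husum.tsum_pos (fun k => (hupos k).le) 0 (hupos 0)
  -- By Markov's inequality the sum of the `|d_k|`, of mean at most `U₀`, reaches `U` with
  -- probability at most `η / 4`.
  set U := 4 * U₀ / η with hU
  have hUpos : 0 < U := by positivity
  obtain ⟨θ₁, hθθ₁, hθ₁1⟩ := exists_between hθ1
  have hθ₁ : 0 < θ₁ := hθ.trans hθθ₁
  set D : ℝ := ((B + 1 : ℕ) : ℝ) with hD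
  have hD0 : 0 ≤ D := Nat.cast_nonneg _
  -- `B'` must precede `ℓ` and `M`, both of which depend on it through `W`. This is possible because
  -- the main term of the trace moments is free of `M` and is summed over all degrees.
  obtain ⟨B', hB'⟩ := exists_trace_threshold hD0 hθ hθθ₁ (show 0 < η / 8 by positivity)
  set V := negBinomCoeff B' θ₁ with hV
  have hVpos : ∀ k, 0 < V k := negBinomCoeff_pos B' hθ₁
  have hVsum : Summable V := summable_negBinomCoeff B' hθ₁.le hθ₁1
  set W := ∑' k, V k with hW
  have hWpos : 0 < W := hVsum.tsum_pos (fun k => (hVpos k).le) 0 (hVpos 0)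
  -- The tails are calibrated so that `u * W` and `U * τ` in the criterion each amount to 1/4; the
  -- coefficient error `δ * W` takes another 1/4.
  obtain ⟨ℓ, hℓV, hℓu⟩ := ((eventually_sum_filter_lt_le hVsum (fun k => (hVpos k).le)
    (show 0 < 1 / (4 * U) by positivity)).and (eventually_sum_filter_lt_le husum
    (fun k => (hupos k).le) (show 0 < 1 / (4 * W) * (η / 4) by positivity))).exists
  set K := 2 * ℓ with hK
  -- Solves `ε * U₀ = 1 / (4 * W) * (η / 4)`, as Markov's inequality requires.
  set ε := η / (16 * W * U₀) with hε
  have hεpos : 0 < ε := by positivity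
  have hM : ∀ᶠ M : ℕ in atTop, ∀ i ∈ Finset.range (K + 1),
      1 - (∫ z, ‖truncate M z‖ ^ 2 ∂ξ) ^ i ≤ ε ^ 2 := by
    rw [Finset.eventually_all]
    intro i _
    have h1 : Tendsto (fun M : ℕ => 1 - (∫ z, ‖truncate M z‖ ^ 2 ∂ξ) ^ i) atTop (𝓝 (1 - 1 ^ i)) :=
      ((tendsto_integral_norm_sq_truncate hvar).pow i).const_sub 1
    rw [one_pow, sub_self] at h1
    exact (h1.eventually_lt_const (show 0 < ε ^ 2 by positivity)).mono fun _ h => h.le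
  obtain ⟨M, hM⟩ := hM.exists
  have hM0 : (0 : ℝ) ≤ M := Nat.cast_nonneg M
  set t : ℕ → ℝ := fun m => ((B' + 1 : ℕ) : ℝ) * θ₁ ^ (m + 1) with ht
  have htpos : ∀ m, 0 < t m := fun m => by rw [ht]; positivity
  obtain ⟨N, hN0, hN⟩ := exists_forall_negligible_le K L M t (show 0 < η / 8 by positivity)
  refine ⟨N, fun n hn b hs htr => ?_⟩
  set μ := Measure.pi fun _ : Fin n × Fin n => ξ with hμ
  set A : (Fin n × Fin n → ℂ) → Matrix (Fin n) (Fin n) ℂ :=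
    fun x => weightedMatrix b fun i j => x (i, j) with hA
  set A' : (Fin n × Fin n → ℂ) → Matrix (Fin n) (Fin n) ℂ :=
    fun x => weightedMatrix b fun i j => truncate M (x (i, j)) with hA'
  have hS0 : ∀ i j, 0 ≤ varianceProfile b i j := fun i j => sq_nonneg _
  have hperm : ∀ k, permanentSum (varianceProfile b) k ≤ u k ^ 2 := fun k =>
    (permanentSum_le_negBinomCoeff hS0 (sq_nonneg θ) (fun j hj => by
      rw [← pow_mul]; exact htr j hj) k).trans (negBinomCoeff_sq_le B k)
  have hLd : ∀ k, MemLp (fun x => (A x).charpolyRev.coeff k) 2 μ := fun k =>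
    memLp_coeff_charpolyRev b measurable_id (integrable_norm_sq_of_integral_eq_one hvar) k
  have hLf : ∀ k, MemLp (fun x => (A' x).charpolyRev.coeff k) 2 μ := fun k =>
    memLp_coeff_charpolyRev b (measurable_truncate M) (integrable_norm_sq_truncate hvar M) k
  have hEd : ∀ k, ∫ x, ‖(A x).charpolyRev.coeff k‖ ^ 2 ∂μ ≤ u k ^ 2 := fun k =>
    (integral_norm_sq_coeff b hsymm hvar k).le.trans (hperm k)
  have hEdf : ∀ k ∈ Finset.range (K + 1),
      ∫ x, ‖(A x).charpolyRev.coeff k - (A' x).charpolyRev.coeff k‖ ^ 2 ∂μ ≤ (ε * u k) ^ 2 :=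
    fun k hk => by
      refine (integral_norm_sq_coeff_sub_truncate b hsymm hvar M k).le.trans ?_
      rw [mul_pow, mul_comm]
      have h1 : 0 ≤ 1 - (∫ z, ‖truncate M z‖ ^ 2 ∂ξ) ^ k :=
        sub_nonneg.2 (pow_le_one₀ (integral_nonneg fun _ => by positivity)
          (integral_norm_sq_truncate_le_one hvar M))
      exact mul_le_mul (hM k hk) (hperm k) (permanentSum_nonneg hS0 k) (by positivity)
  -- Larger than `n`, to include all coefficients, and than `K`, to include whole antidiagonals.
  set R := n + K + 1 with hR
  have hE1 : μ.real {x | U ≤ ∑ i ∈ Finset.range R, ‖(A x).charpolyRev.coeff i‖} ≤ η / 4 := by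
    refine measureReal_ge_le_of_sum_norm _ (fun i _ => hLd i) (fun i _ => hupos i)
      (fun i _ => hEd i) hUpos ?_
    refine (husum.sum_le_tsum _ fun i _ => (hupos i).le).trans (le_of_eq ?_)
    rw [hU, ← hU₀]; field_simp
  have hE2 : μ.real {x | 1 / (4 * W) ≤
      ∑ i ∈ (Finset.range R).filter (ℓ < ·), ‖(A x).charpolyRev.coeff i‖} ≤ η / 4 :=
    measureReal_ge_le_of_sum_norm _ (fun i _ => hLd i) (fun i _ => hupos i)
      (fun i _ => hEd i) (by positivity) (hℓu R)
  have hE3 : μ.real {x | 1 / (4 * W) ≤ ∑ i ∈ Finset.range (K + 1),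
      ‖(A x).charpolyRev.coeff i - (A' x).charpolyRev.coeff i‖} ≤ η / 4 := by
    refine measureReal_ge_le_of_sum_norm _ (fun i _ => (hLd i).sub (hLf i))
      (fun i _ => mul_pos hεpos (hupos i)) hEdf (by positivity) ?_
    rw [← Finset.mul_sum]
    refine (mul_le_mul_of_nonneg_left (husum.sum_le_tsum _ fun i _ => (hupos i).le)
      hεpos.le).trans (le_of_eq ?_)
    rw [hε]; field_simp; ring
  have hE4 : μ.real {x | ∃ m ∈ Finset.range K, t m ≤ ‖((A' x) ^ (m + 1)).trace‖} ≤ η / 4 := by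
    refine (measureReal_exists_ge_le _ (fun m _ => memLp_trace_pow b hM0 m) (fun m _ => htpos m)
      (fun m _ => integral_norm_sq_trace_le hsymm hvar hM0 hD0 hθ.le
        (div_nonneg hL (Nat.cast_nonneg n)) hs htr m)).trans ?_
    simp only [add_div]
    rw [Finset.sum_add_distrib]
    have := add_le_add (hB' K) (hN n hn)
    linarith
  have hsub : {x | ∃ z : ℂ, ‖z‖ ≤ 1 ∧ (1 - z • A x).det = 0} ⊆
      ({x | U ≤ ∑ i ∈ Finset.range R, ‖(A x).charpolyRev.coeff i‖} ∪
        {x | 1 / (4 * W) ≤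
          ∑ i ∈ (Finset.range R).filter (ℓ < ·), ‖(A x).charpolyRev.coeff i‖}) ∪
      ({x | 1 / (4 * W) ≤ ∑ i ∈ Finset.range (K + 1),
        ‖(A x).charpolyRev.coeff i - (A' x).charpolyRev.coeff i‖} ∪
        {x | ∃ m ∈ Finset.range K, t m ≤ ‖((A' x) ^ (m + 1)).trace‖}) := by
    rintro x ⟨z, hz, hdet⟩
    by_contra hx
    simp only [Set.mem_union, Set.mem_ofPred_eq, not_or, not_le, not_exists, not_and] at hx
    obtain ⟨⟨hx1, hx2⟩, hx3, hx4⟩ := hx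
    refine det_one_sub_smul_ne_zero (A := A x) (A' := A' x) (V := V) (ℓ := ℓ) (R := R)
      (by rw [Fintype.card_fin]; omega) (by omega) (fun j => (hVpos j).le)
      (norm_invRevCoeff_le hθ₁.le fun j hj hjK => ?_)
      (hVsum.sum_le_tsum _ fun j _ => (hVpos j).le) (hℓV _) hx1.le hx2.le hx3.le ?_ hz hdet
    · obtain ⟨m, rfl⟩ : ∃ m, j = m + 1 := ⟨j - 1, by omega⟩
      exact (hx4 m (Finset.mem_range.2 (by omega))).le
    · have h1 : 1 / (4 * W) * W = 1 / 4 := by field_simp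
      have h2 : U * (1 / (4 * U)) = 1 / 4 := by field_simp
      rw [h1, h2]
      norm_num
  calc μ.real {x | ∃ z : ℂ, ‖z‖ ≤ 1 ∧ (1 - z • A x).det = 0} ≤ _ := measureReal_mono hsub
    _ ≤ _ := measureReal_union_le _ _
    _ ≤ _ := add_le_add (measureReal_union_le _ _) (measureReal_union_le _ _)
    _ ≤ (η / 4 + η / 4) + (η / 4 + η / 4) := add_le_add (add_le_add hE1 hE2) (add_le_add hE3 hE4)
    _ = η := by ring

end Core

/-! ### Spectral radius, determinants and row sums. -/

section SpectralRadius

variable {n : ℕ}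

theorem lt_rho_iff {M : Matrix (Fin n) (Fin n) ℂ} {r : ℝ} (hr : 0 ≤ r) :
    r < rho M ↔ ∃ lam ∈ spectrum ℂ M, r < ‖lam‖ := by
  have h1 : r < rho M ↔ ENNReal.ofReal r < spectralRadius ℂ M := by
    rw [rho, ENNReal.ofReal_lt_iff_lt_toReal hr (spectralRadius_matrix_lt_top M).ne]
  rw [h1, spectralRadius]
  simp only [lt_iSup_iff, exists_prop]
  refine exists_congr fun lam => and_congr_right fun _ => ?_
  exact ENNReal.ofReal_lt_coe_iff hr

/-- For an eigenvalue `lam` of modulus above `r`, the zero is `z = r / lam`. -/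
theorem exists_det_eq_zero_of_lt_rho {b : Matrix (Fin n) (Fin n) ℝ}
    {x : Matrix (Fin n) (Fin n) ℂ} {r : ℝ} (hr : 0 < r) (h : r < rho (weightedMatrix b x)) :
    ∃ z : ℂ, ‖z‖ ≤ 1 ∧ (1 - z • weightedMatrix (r⁻¹ • b) x).det = 0 := by
  obtain ⟨lam, hlam, hlt⟩ := (lt_rho_iff hr.le).1 h
  have hlam0 : lam ≠ 0 := norm_pos_iff.1 (hr.trans hlt)
  have hrC : (r : ℂ) ≠ 0 := Complex.ofReal_ne_zero.2 hr.ne'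
  have hdet : (algebraMap ℂ (Matrix (Fin n) (Fin n) ℂ) lam - weightedMatrix b x).det = 0 := by
    by_contra hne
    exact hlam ((Matrix.isUnit_iff_isUnit_det _).2 (isUnit_iff_ne_zero.2 hne))
  refine ⟨r / lam, ?_, ?_⟩
  · rw [norm_div, Complex.norm_real, Real.norm_of_nonneg hr.le]
    exact (div_le_one (hr.trans hlt)).2 hlt.le
  · have : (1 - ((r : ℂ) / lam) • weightedMatrix (r⁻¹ • b) x) =
        lam⁻¹ • (algebraMap ℂ (Matrix (Fin n) (Fin n) ℂ) lam - weightedMatrix b x) := by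
      ext i j
      simp only [Matrix.sub_apply, Matrix.smul_apply, weightedMatrix, Matrix.of_apply, smul_eq_mul,
        Matrix.algebraMap_matrix_apply, Matrix.one_apply, Algebra.algebraMap_self_apply]
      push_cast
      split_ifs
      · field_simp
      · field_simp
        ring
    rw [this, Matrix.det_smul, hdet, mul_zero]

open scoped Matrix.Norms.Operator

theorem rho_le_of_row_sum_le (hn : 0 < n) {M : Matrix (Fin n) (Fin n) ℂ} {C : ℝ} (hC : 0 ≤ C)
    (h : ∀ i, ∑ j, ‖M i j‖ ≤ C) : rho M ≤ C := by
  have : Nonempty (Fin n) := ⟨⟨0, hn⟩⟩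
  have h1 : spectralRadius ℂ M ≤ ‖M‖₊ := spectrum.spectralRadius_le_nnnorm M
  have h2 : ‖M‖ ≤ C := by
    have h3 : ‖M‖₊ ≤ C.toNNReal := by
      rw [Matrix.linfty_opNNNorm_def]
      refine Finset.sup_le fun i _ => ?_
      rw [← NNReal.coe_le_coe, Real.coe_toNNReal _ hC]
      push_cast
      exact h i
    calc ‖M‖ = ((‖M‖₊ : NNReal) : ℝ) := rfl
      _ ≤ (C.toNNReal : ℝ) := by exact_mod_cast h3
      _ = C := Real.coe_toNNReal _ hC
  exact (ENNReal.toReal_mono ENNReal.coe_ne_top h1).trans h2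

theorem sum_row_mul {S T : Matrix (Fin n) (Fin n) ℝ} (i : Fin n) :
    ∑ j, (S * T) i j = ∑ k, S i k * ∑ j, T k j := by
  simp only [Matrix.mul_apply, Finset.mul_sum]
  exact Finset.sum_comm

theorem pow_apply_nonneg {S : Matrix (Fin n) (Fin n) ℝ} (hS : ∀ i j, 0 ≤ S i j) (m : ℕ)
    (i j : Fin n) : 0 ≤ (S ^ m) i j := by
  induction m generalizing i j with
  | zero => by_cases h : i = j <;> simp [h]
  | succ m ih =>
    rw [pow_succ, Matrix.mul_apply]
    exact Finset.sum_nonneg fun k _ => mul_nonneg (ih i k) (hS k j)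

theorem pow_le_row_sum_pow {S : Matrix (Fin n) (Fin n) ℝ} (hS : ∀ i j, 0 ≤ S i j) {α : ℝ}
    (hα : 0 ≤ α) (h : ∀ i, α ≤ ∑ j, S i j) (m : ℕ) (i : Fin n) : α ^ m ≤ ∑ j, (S ^ m) i j := by
  induction m generalizing i with
  | zero => simp [Matrix.one_apply]
  | succ m ih =>
    rw [pow_succ', pow_succ', sum_row_mul]
    calc α * α ^ m ≤ (∑ k, S i k) * α ^ m := mul_le_mul_of_nonneg_right (h i) (by positivity)
      _ = ∑ k, S i k * α ^ m := Finset.sum_mul _ _ _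
      _ ≤ _ := Finset.sum_le_sum fun k _ => mul_le_mul_of_nonneg_left (ih k) (hS i k)

theorem row_sum_pow_le {S : Matrix (Fin n) (Fin n) ℝ} (hS : ∀ i j, 0 ≤ S i j) {α : ℝ}
    (hα : 0 ≤ α) (h : ∀ i, ∑ j, S i j ≤ α) (m : ℕ) (i : Fin n) : ∑ j, (S ^ m) i j ≤ α ^ m := by
  induction m generalizing i with
  | zero => simp [Matrix.one_apply]
  | succ m ih =>
    rw [pow_succ', pow_succ', sum_row_mul]
    calc _ ≤ ∑ k, S i k * α ^ m :=
          Finset.sum_le_sum fun k _ => mul_le_mul_of_nonneg_left (ih k) (hS i k)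
      _ = (∑ k, S i k) * α ^ m := (Finset.sum_mul _ _ _).symm
      _ ≤ α * α ^ m := mul_le_mul_of_nonneg_right (h i) (by positivity)

/-- The spectral radius of a nonnegative matrix is at least its smallest row sum. -/
theorem le_rho_of_le_row_sum (hn : 0 < n) {S : Matrix (Fin n) (Fin n) ℝ} (hS : ∀ i j, 0 ≤ S i j)
    {α : ℝ} (hα : 0 ≤ α) (h : ∀ i, α ≤ ∑ j, S i j) : α ≤ rho (S.map Complex.ofReal) := by
  -- Gelfand's formula in the ℓ∞ operator norm, which dominates each row sum of the `m`-th power and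
  -- hence `α ^ m`.
  have hlim := spectrum.pow_norm_pow_one_div_tendsto_nhds_spectralRadius (S.map Complex.ofReal)
  have hge : ENNReal.ofReal α ≤ spectralRadius ℂ (S.map Complex.ofReal) := by
    refine ge_of_tendsto hlim ?_
    filter_upwards [eventually_ge_atTop 1] with m hm
    refine ENNReal.ofReal_le_ofReal ?_
    have hpow : (S.map Complex.ofReal) ^ m = (S ^ m).map Complex.ofReal :=
      (map_pow (Complex.ofRealHom.mapMatrix) S m).symm
    have h1 : α ^ m ≤ ‖(S.map Complex.ofReal) ^ m‖ := by
      rw [hpow, Matrix.linfty_opNorm_def]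
      have h2 : ∑ j, ‖((S ^ m).map Complex.ofReal) ⟨0, hn⟩ j‖₊ ≤
          Finset.univ.sup fun i => ∑ j, ‖((S ^ m).map Complex.ofReal) i j‖₊ :=
        Finset.le_sup (f := fun i => ∑ j, ‖((S ^ m).map Complex.ofReal) i j‖₊)
          (Finset.mem_univ (⟨0, hn⟩ : Fin n))
      refine le_trans ?_ (NNReal.coe_le_coe.2 h2)
      push_cast
      refine (pow_le_row_sum_pow hS hα h m ⟨0, hn⟩).trans (le_of_eq ?_)
      refine Finset.sum_congr rfl fun j _ => ?_
      rw [Matrix.map_apply, Complex.norm_real, Real.norm_of_nonneg (pow_apply_nonneg hS m _ _)]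
    have hm0 : m ≠ 0 := by omega
    calc α = (α ^ m) ^ (1 / m : ℝ) := by
          rw [one_div, Real.pow_rpow_inv_natCast hα hm0]
      _ ≤ _ := Real.rpow_le_rpow (by positivity) h1 (by positivity)
  rw [rho]
  exact (ENNReal.ofReal_le_iff_le_toReal (spectralRadius_matrix_lt_top _).ne).1 hge

theorem rho_nonneg (M : Matrix (Fin n) (Fin n) ℂ) : 0 ≤ rho M := ENNReal.toReal_nonneg

theorem rho_pow_le (M : Matrix (Fin n) (Fin n) ℂ) {j : ℕ} (hj : 0 < j) :
    rho (M ^ j) ≤ rho M ^ j := by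
  by_contra hlt
  push Not at hlt
  obtain ⟨lam, hlam, hlt'⟩ := (lt_rho_iff (pow_nonneg (rho_nonneg M) j)).1 hlt
  rw [spectrum.map_pow_of_pos M hj] at hlam
  obtain ⟨κ, hκ, rfl⟩ := hlam
  rw [norm_pow] at hlt'
  have := lt_of_pow_lt_pow_left₀ j (norm_nonneg _) hlt'
  exact lt_irrefl _ ((lt_rho_iff (rho_nonneg M)).2 ⟨κ, hκ, this⟩)

end SpectralRadius

/-! ### Traces of powers of the variance profile. -/

section TraceBounds

variable {n : ℕ} {S : Matrix (Fin n) (Fin n) ℝ}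

/-- Bounding the closing step by `L` frees the endpoint: closed walks become arbitrary walks of `m`
steps. -/
theorem trace_pow_succ_le (hS : ∀ i j, 0 ≤ S i j) {L : ℝ} (hL : ∀ i j, S i j ≤ L) (m : ℕ) :
    (S ^ (m + 1)).trace ≤ L * ∑ i, ∑ k, (S ^ m) i k := by
  rw [pow_succ, Matrix.trace, Finset.mul_sum]
  refine Finset.sum_le_sum fun i _ => ?_
  rw [Matrix.diag_apply, Matrix.mul_apply, Finset.mul_sum]
  refine Finset.sum_le_sum fun k _ => ?_
  rw [mul_comm]
  exact mul_le_mul_of_nonneg_right (hL k i) (pow_apply_nonneg hS m i k)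

theorem trace_pow_le_of_row_sum_le (hn : 0 < n) (hS : ∀ i j, 0 ≤ S i j) {C σ : ℝ}
    (hC : ∀ i j, S i j ≤ C / n) (hσ : ∀ i, ∑ j, S i j ≤ σ ^ 2) (m : ℕ) :
    (S ^ (m + 1)).trace ≤ C * σ ^ (2 * m) := by
  have hn' : (0 : ℝ) < n := by exact_mod_cast hn
  have hC0 : 0 ≤ C / n := (hS ⟨0, hn⟩ ⟨0, hn⟩).trans (hC _ _)
  refine (trace_pow_succ_le hS hC m).trans ?_
  have h1 : ∑ i, ∑ k, (S ^ m) i k ≤ n * σ ^ (2 * m) := by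
    refine (Finset.sum_le_sum fun i _ => row_sum_pow_le hS (sq_nonneg σ) hσ m i).trans ?_
    rw [Finset.sum_const, Finset.card_univ, Fintype.card_fin, nsmul_eq_mul, pow_mul]
  calc _ ≤ C / n * (n * σ ^ (2 * m)) := mul_le_mul_of_nonneg_left h1 hC0
    _ = _ := by field_simp

/-- Both sides are compared with the sum `Q` of all entries of `S ^ m`: the trace is at most `C / n
* Q`, while every row sum of `S ^ (m + 1)`, and so its spectral radius, is at least `c / n * Q`. -/
theorem trace_pow_le_rho_pow (hn : 0 < n) {c C : ℝ} (hc : 0 < c) (hlow : ∀ i j, c / n ≤ S i j)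
    (hC : ∀ i j, S i j ≤ C / n) (m : ℕ) :
    (S ^ (m + 1)).trace ≤ C / c * rho (S.map Complex.ofReal) ^ (m + 1) := by
  have hn' : (0 : ℝ) < n := by exact_mod_cast hn
  have hcn : 0 < c / n := by positivity
  have hS : ∀ i j, 0 ≤ S i j := fun i j => hcn.le.trans (hlow i j)
  have hC0 : 0 ≤ C := by
    have := (hS ⟨0, hn⟩ ⟨0, hn⟩).trans (hC _ _)
    rw [div_nonneg_iff] at this
    rcases this with h | h
    · exact h.1
    · linarith [h.2]
  set Q := ∑ i, ∑ k, (S ^ m) i k with hQ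
  have hQ0 : 0 ≤ Q := Finset.sum_nonneg fun i _ => Finset.sum_nonneg fun k _ =>
    pow_apply_nonneg hS m i k
  have h1 : c / n * Q ≤ rho (S.map Complex.ofReal) ^ (m + 1) := by
    have hpow : (S.map Complex.ofReal) ^ (m + 1) = (S ^ (m + 1)).map Complex.ofReal :=
      (map_pow (Complex.ofRealHom.mapMatrix) S (m + 1)).symm
    refine le_trans ?_ (rho_pow_le _ (Nat.succ_pos m))
    rw [hpow]
    refine le_rho_of_le_row_sum hn (pow_apply_nonneg hS _) (by positivity) fun i => ?_
    rw [pow_succ', sum_row_mul, hQ, Finset.mul_sum]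
    exact Finset.sum_le_sum fun k _ => mul_le_mul_of_nonneg_right (hlow i k)
      (Finset.sum_nonneg fun j _ => pow_apply_nonneg hS m k j)
  calc _ ≤ C / n * Q := trace_pow_succ_le hS hC m
    _ = C / c * (c / n * Q) := by field_simp
    _ ≤ _ := mul_le_mul_of_nonneg_left h1 (by positivity)

theorem row_sum_le_of_entry_le (hn : 0 < n) {C : ℝ} (hC : ∀ i j, S i j ≤ C / n) (i : Fin n) :
    ∑ j, S i j ≤ C := by
  have hn' : (n : ℝ) ≠ 0 := by exact_mod_cast hn.ne'
  refine (Finset.sum_le_sum fun j _ => hC i j).trans (le_of_eq ?_)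
  rw [Finset.sum_const, Finset.card_univ, Fintype.card_fin, nsmul_eq_mul]
  field_simp

theorem maxRowColumn_nonneg (S : Matrix (Fin n) (Fin n) ℝ) : 0 ≤ maxRowColumn S :=
  le_max_of_le_left (Real.iSup_nonneg fun _ => Real.sqrt_nonneg _)

theorem row_sum_le_maxRowColumn_sq (hS : ∀ i j, 0 ≤ S i j) (i : Fin n) :
    ∑ j, S i j ≤ maxRowColumn S ^ 2 := by
  have h1 : √(∑ j, S i j) ≤ maxRowColumn S :=
    (le_ciSup (f := fun i => √(∑ j, S i j)) (Set.finite_range _).bddAbove i).trans (le_max_left _ _)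
  have h2 := pow_le_pow_left₀ (Real.sqrt_nonneg _) h1 2
  rwa [Real.sq_sqrt (Finset.sum_nonneg fun j _ => hS i j)] at h2

theorem maxRowColumn_le (hn : 0 < n) {C : ℝ} (hC : ∀ i j, S i j ≤ C / n) :
    maxRowColumn S ≤ √C := by
  refine max_le (Real.iSup_le (fun i => ?_) (Real.sqrt_nonneg _))
    (Real.iSup_le (fun j => ?_) (Real.sqrt_nonneg _))
  · exact Real.sqrt_le_sqrt (row_sum_le_of_entry_le hn hC i)
  · exact Real.sqrt_le_sqrt (row_sum_le_of_entry_le (S := S.transpose) hn (fun i j => hC j i) j)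

end TraceBounds

/-! ### From the zero-free disc to the spectral radius. -/

section Main

variable {ξ : Measure ℂ} [IsProbabilityMeasure ξ]

/-- The spectral radius exceeds `r + δ` with small probability as soon as the traces of the powers
of the variance profile grow at most like `r ^ (2 j)`. -/
theorem exists_forall_measureReal_lt_rho_le (hsymm : ξ.map (fun z => -z) = ξ)
    (hvar : ∫ z, ‖z‖ ^ 2 ∂ξ = 1) {L D r₀ δ η : ℝ} (hL : 0 ≤ L) (hr₀ : 0 < r₀)
    (hδ : 0 < δ) (hη : 0 < η) :
    ∃ N : ℕ, ∀ n ≥ N, ∀ (b : Matrix (Fin n) (Fin n) ℝ) (r : ℝ), 0 ≤ r → r ≤ r₀ →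
      (∀ i j, varianceProfile b i j ≤ L / n) →
      (∀ m, (varianceProfile b ^ (m + 1)).trace ≤ D * r ^ (2 * (m + 1))) →
      (Measure.pi fun _ : Fin n × Fin n => ξ).real
        {x | r + δ < rho (weightedMatrix b fun i j => x (i, j))} ≤ η := by
  obtain ⟨B, hB⟩ := exists_nat_ge D
  -- The ratio `r / (r + δ)` increases with `r`, so this value serves all `r ≤ r₀`, uniformly in
  -- `n`.
  set θ := r₀ / (r₀ + δ) with hθ
  have hθ0 : 0 < θ := by positivity
  have hθ1 : θ < 1 := (div_lt_one (by positivity)).2 (by linarith)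
  obtain ⟨N, hN⟩ := exists_forall_measureReal_zero_le hsymm hvar B hθ0 hθ1
    (L := L / δ ^ 2) (by positivity) hη
  refine ⟨N, fun n hn b r hr hrr₀ hs htr => ?_⟩
  set s := r + δ with hs'
  have hspos : 0 < s := by positivity
  have hprof : varianceProfile (s⁻¹ • b) = (s⁻¹ ^ 2) • varianceProfile b := by
    ext i j
    simp [varianceProfile, mul_pow]
  refine (measureReal_mono fun x hx => exists_det_eq_zero_of_lt_rho hspos hx).trans
    (hN n hn (s⁻¹ • b) (fun i j => ?_) fun j hj => ?_)
  · rw [hprof, Matrix.smul_apply, smul_eq_mul]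
    have h1 : s⁻¹ ^ 2 ≤ (δ ^ 2)⁻¹ := by
      rw [inv_pow]
      exact inv_anti₀ (by positivity) (pow_le_pow_left₀ hδ.le (by linarith) 2)
    calc _ ≤ (δ ^ 2)⁻¹ * (L / n) := mul_le_mul h1 (hs i j) (sq_nonneg _) (by positivity)
      _ = _ := by ring
  · obtain ⟨m, rfl⟩ : ∃ m, j = m + 1 := ⟨j - 1, by omega⟩
    rw [hprof, smul_pow, Matrix.trace_smul, smul_eq_mul, ← pow_mul]
    have h1 : r / s ≤ θ := by
      rw [hθ, hs', div_le_div_iff₀ hspos (by positivity)]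
      nlinarith
    have h2 : (r / s) ^ (2 * (m + 1)) ≤ θ ^ (2 * (m + 1)) :=
      pow_le_pow_left₀ (by positivity) h1 _
    have hBD : D ≤ ((B + 1 : ℕ) : ℝ) := by push_cast; linarith
    calc _ ≤ s⁻¹ ^ (2 * (m + 1)) * (D * r ^ (2 * (m + 1))) :=
          mul_le_mul_of_nonneg_left (htr m) (by positivity)
      _ = D * (r / s) ^ (2 * (m + 1)) := by rw [div_eq_mul_inv, mul_pow]; ring
      _ ≤ ((B + 1 : ℕ) : ℝ) * (r / s) ^ (2 * (m + 1)) :=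
          mul_le_mul_of_nonneg_right hBD (by positivity)
      _ ≤ _ := mul_le_mul_of_nonneg_left h2 (Nat.cast_nonneg _)

/-- Passage from estimates on the canonical product space to convergence of probabilities. -/
theorem tendsto_measure_rho_le {Ω : ℕ → Type*} [∀ n, MeasurableSpace (Ω n)]
    {P : ∀ n, Measure (Ω n)} [∀ n, IsProbabilityMeasure (P n)]
    {x : ∀ n, Fin n → Fin n → Ω n → ℂ} (hlaw : ∀ n i j, HasLaw (x n i j) ξ (P n))
    (hindep : ∀ n, iIndepFun (fun p : Fin n × Fin n => x n p.1 p.2) (P n))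
    {b : ∀ n, Matrix (Fin n) (Fin n) ℝ} {f : ℕ → ℝ}
    (h : ∀ η : ℝ, 0 < η → ∃ N : ℕ, ∀ n ≥ N, (Measure.pi fun _ : Fin n × Fin n => ξ).real
      {y | f n < rho (weightedMatrix (b n) fun i j => y (i, j))} ≤ η) :
    Tendsto (fun n => P n {ω | rho (weightedMatrix (b n) (fun i j => x n i j ω)) ≤ f n})
      atTop (𝓝 1) := by
  have hbad : Tendsto (fun n =>
      P n {ω | f n < rho (weightedMatrix (b n) (fun i j => x n i j ω))}) atTop (𝓝 0) := by
    rw [ENNReal.tendsto_nhds_zero]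
    intro ε hε
    have hη : 0 < (min ε 1).toReal :=
      ENNReal.toReal_pos (lt_min hε one_pos).ne' (min_lt_of_right_lt ENNReal.one_lt_top).ne
    obtain ⟨N, hN⟩ := h _ hη
    filter_upwards [eventually_ge_atTop N] with n hn
    have hae : ∀ p : Fin n × Fin n, AEMeasurable (x n p.1 p.2) (P n) :=
      fun p => (hlaw n p.1 p.2).aemeasurable
    have hmap : (P n).map (fun ω (p : Fin n × Fin n) => x n p.1 p.2 ω) =
        Measure.pi fun _ : Fin n × Fin n => ξ := by
      rw [(hindep n).map_fun_eq_pi_map hae]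
      congr 1
      funext p
      exact (hlaw n p.1 p.2).map_eq
    -- This inequality holds for arbitrary sets, so measurability of the event is not needed.
    have h1 := Measure.le_map_apply (aemeasurable_pi_lambda _ hae)
      {y : Fin n × Fin n → ℂ | f n < rho (weightedMatrix (b n) fun i j => y (i, j))}
    rw [hmap] at h1
    refine h1.trans ?_
    rw [← ENNReal.ofReal_toReal (measure_ne_top _ _)]
    refine (ENNReal.ofReal_le_ofReal (hN n hn)).trans ?_
    rw [ENNReal.ofReal_toReal (min_lt_of_right_lt ENNReal.one_lt_top).ne]
    exact min_le_left _ _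
  -- Subadditivity replaces the complement rule, again avoiding measurability of the event.
  have hlow : Tendsto (fun n => 1 -
      P n {ω | f n < rho (weightedMatrix (b n) (fun i j => x n i j ω))}) atTop (𝓝 1) := by
    have := ENNReal.Tendsto.sub (tendsto_const_nhds (x := (1 : ENNReal))) hbad
      (Or.inl ENNReal.one_ne_top)
    rwa [tsub_zero] at this
  refine tendsto_of_tendsto_of_tendsto_of_le_of_le hlow tendsto_const_nhds (fun n => ?_)
    fun n => prob_le_one
  rw [tsub_le_iff_right]
  calc (1 : ENNReal) = P n Set.univ := measure_univ.symm
    _ ≤ P n ({ω | rho (weightedMatrix (b n) (fun i j => x n i j ω)) ≤ f n} ∪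
        {ω | f n < rho (weightedMatrix (b n) (fun i j => x n i j ω))}) :=
      measure_mono fun ω _ =>
        le_or_gt (rho (weightedMatrix (b n) fun i j => x n i j ω)) (f n)
    _ ≤ _ := measure_union_le _ _

end Main

theorem theorem1p9
    -- the law of `ξ`
    (ξ : Measure ℂ) [IsProbabilityMeasure ξ]
    (hsymm : ξ.map (fun z => -z) = ξ)
    (hmean : ∫ z, z ∂ξ = 0)
    (hvar : ∫ z, ‖z‖ ^ 2 ∂ξ = 1)
    (ε : ℝ) (hε : 0 < ε)
    (hmoment : Integrable (fun z : ℂ => ‖z‖ ^ (2 + ε)) ξ)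
    -- for every `n`, an `n × n` array of i.i.d. variables with law `ξ`
    {Ω : ℕ → Type*} [∀ n, MeasurableSpace (Ω n)]
    (P : ∀ n, Measure (Ω n)) [∀ n, IsProbabilityMeasure (P n)]
    (x : ∀ n, Fin n → Fin n → Ω n → ℂ)
    (hlaw : ∀ n i j, HasLaw (x n i j) ξ (P n))
    (hindep : ∀ n, iIndepFun (fun p : Fin n × Fin n => x n p.1 p.2) (P n))
    -- for every `n`, the deterministic coefficients
    (b : ∀ n, Matrix (Fin n) (Fin n) ℝ)
    (C : ℝ) (hC : 0 < C)
    (hupper : ∀ n i j, varianceProfile (b n) i j ≤ C / n) :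
    -- (1) with probability `1 - o(1)`, `limsup (ρ(A) - σ) ≤ 0`
    (∀ δ : ℝ, 0 < δ →
      Tendsto (fun n => P n {ω | rho (weightedMatrix (b n) (fun i j => x n i j ω)) ≤
          maxRowColumn (varianceProfile (b n)) + δ})
        atTop (𝓝 1)) ∧
    -- (2) under a lower bound, with probability `1 - o(1)`, `ρ(A) ≤ √ρ(S) + δ`
    (∀ c : ℝ, 0 < c → (∀ n i j, c / n ≤ varianceProfile (b n) i j) →
      ∀ δ : ℝ, 0 < δ →
        Tendsto (fun n => P n {ω | rho (weightedMatrix (b n) (fun i j => x n i j ω)) ≤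
            √(rho ((varianceProfile (b n)).map Complex.ofReal)) + δ})
          atTop (𝓝 1)) := by
  have hS : ∀ n i j, 0 ≤ varianceProfile (b n) i j := fun n i j => sq_nonneg _
  refine ⟨fun δ hδ => tendsto_measure_rho_le hlaw hindep fun η hη => ?_,
    fun c hc hlow δ hδ => tendsto_measure_rho_le hlaw hindep fun η hη => ?_⟩
  -- The bound `C * σ ^ (2 * m)` lacks a factor `σ ^ 2`, and `σ` may be arbitrarily small. The
  -- radius `σ + δ / 2` supplies it at the cost of `(δ / 2) ^ 2` in the denominator of `D`; the
  -- other `δ / 2` is the margin.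
  · obtain ⟨N, hN⟩ := exists_forall_measureReal_lt_rho_le hsymm hvar (L := C)
      (D := C / (δ / 2) ^ 2) (r₀ := √C + δ / 2) (δ := δ / 2) hC.le (by positivity)
      (by positivity) hη
    refine ⟨N + 1, fun n hn => ?_⟩
    have hn0 : 0 < n := by omega
    set σ := maxRowColumn (varianceProfile (b n)) with hσ
    have hσ0 : 0 ≤ σ := maxRowColumn_nonneg _
    have h1 := hN n (by omega) (b n) (σ + δ / 2) (by positivity)
      (by linarith [maxRowColumn_le hn0 (hupper n)]) (hupper n) fun m => by
        refine (trace_pow_le_of_row_sum_le hn0 (hS n) (hupper n)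
          (row_sum_le_maxRowColumn_sq (hS n)) m).trans ?_
        have h2 : σ ^ (2 * m) ≤ (σ + δ / 2) ^ (2 * m) :=
          pow_le_pow_left₀ hσ0 (by linarith) _
        have h3 : (δ / 2) ^ 2 ≤ (σ + δ / 2) ^ 2 := pow_le_pow_left₀ (by positivity) (by linarith) _
        calc C * σ ^ (2 * m) = C / (δ / 2) ^ 2 * (σ ^ (2 * m) * (δ / 2) ^ 2) := by field_simp
          _ ≤ C / (δ / 2) ^ 2 * ((σ + δ / 2) ^ (2 * m) * (σ + δ / 2) ^ 2) :=
              mul_le_mul_of_nonneg_left (mul_le_mul h2 h3 (by positivity) (by positivity))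
                (by positivity)
          _ = _ := by rw [mul_add 2 m 1, pow_add]
    rwa [add_assoc, add_halves] at h1
  -- The trace bound already has the full power of `ρ(S)`, so all of `δ` is margin; `r₀ = √C`
  -- because the row sums are at most `C`.
  · obtain ⟨N, hN⟩ := exists_forall_measureReal_lt_rho_le hsymm hvar (L := C)
      (D := C / c) (r₀ := √C) (δ := δ) hC.le (by positivity) hδ hη
    refine ⟨N + 1, fun n hn => ?_⟩
    have hn0 : 0 < n := by omega
    refine hN n (by omega) (b n) _ (Real.sqrt_nonneg _) (Real.sqrt_le_sqrt ?_) (hupper n)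
      fun m => ?_
    · refine rho_le_of_row_sum_le hn0 hC.le fun i => ?_
      refine le_trans (le_of_eq (Finset.sum_congr rfl fun j _ => ?_))
        (row_sum_le_of_entry_le hn0 (hupper n) i)
      rw [Matrix.map_apply, Complex.norm_real, Real.norm_of_nonneg (hS n i j)]
    · rw [pow_mul, Real.sq_sqrt (rho_nonneg _)]
      exact trace_pow_le_rho_pow hn0 hc (hlow n) (hupper n) m
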